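/- A read-once oblivious algebraic branching program (ABP) over a field $\mathbb{F}$ in the variables $x_1,\dots,x_D$, of depth $D$ and individual degree $<n$, is a directed graph whose vertices are partitioned into levels $0,\dots,D$, where level $0$ consists of a single vertex (the source, the only vertex of in-degree zero), level $D$ consists of a single vertex (the sink, the only vertex of out-degree zero), and every edge goes from level $i-1$ to level $i$ for some $1\le i\le D$ and is labelled by a univariate polynomial of degree $<n$ in $x_i$. It computes the polynomial in $\mathbb{F}[x_1,\dots,x_D]$ that is the sum, over all source-sink paths, of the products of the labels along the path. Its width is the maximum number of vertices in a level. A set $\mathcal{H}\subseteq\mathbb{F}^D$ is a hitting set for a class $\mathcal{C}$ of $D$-variate polynomials if every $f\in\mathcal{C}$ is the zero polynomial if and only if $f$ vanishes on $\mathcal{H}$. **Theorem.** Let $r$ be a constant. There are a constant $c$ and a random access machine program $P$, both depending only on $r$, such that the following holds for all $D,n\ge 0$ and every field $\mathbb{F}$ (given by an enumeration of pairwise distinct elements: all of its elements if $\mathbb{F}$ is finite, infinitely many if it is infinite) with $|\mathbb{F}|\ge (D+n+2)^{c}$. Let $\mathcal{C}$ be the set of $D$-variate polynomials computable by read-once oblivious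 ABPs over $\mathbb{F}$ of width at most $r$, depth $D$ and individual degree $<n$. Then $\mathcal{C}$ has a hitting set $\mathcal{H}=\{h_0,\dots,h_{N-1}\}\subseteq\mathbb{F}^D$ (repetitions allowed) of size $$N\le (D+n+2)^{\,c\cdot \lg D/\lg\lg D},$$ where $\lg=\log_2$ and $\lg D/\lg\lg D$ is read as $1$ for $D\le 2$, and $\mathcal{H}$ is $\mathrm{poly}(D,n)$-explicit: on input $D$, $n$ and an index $k<N$, the program $P$ outputs the $D$ coordinates of $h_k$ in time at most $(D+n+2)^{c}$. Here the machine has a memory of natural numbers and a memory of field elements, both with indirect addressing; arithmetic operations and comparisons of natural numbers have logarithmic cost (the bit lengths of the operands), arithmetic operations and equality tests in $\mathbb{F}$ have unit cost (plus the bit lengths of the addresses), and obtaining the $j$-th element of the enumeration of $\mathbb{F}$ costs $j+1$ (plus the bit length of the target address). -/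

import Mathlib

open Polynomial

noncomputable section

namespace ROABP

/-! ## Read-once oblivious algebraic branching programs -/

/-- A read-once oblivious algebraic branching program in the variables `x_0, …, x_{D-1}`, of depth
`D` and individual degree `< n`: a layered directed graph whose level `i` has the vertices
`0, …, numNodes i - 1`. The edges between the levels `i` and `i + 1` carry univariate polynomials of
degree `< n` in the variable `x_i`; `label i u v = none` means that there is no edge from `u` to `v`.
Levels `0` and `D` consist of the source and of the sink; the source is the only vertex
of in-degree zero and the sink is the only vertex of out-degree zero. -/
structure Branching (F : Type*) [Field F] (D n : ℕ) where
  numNodes : Fin (D + 1) → ℕ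
  label : ∀ i : Fin D, Fin (numNodes i.castSucc) → Fin (numNodes i.succ) → Option F[X]
  source_unique : numNodes 0 = 1
  sink_unique : numNodes (Fin.last D) = 1
  exists_in : ∀ (i : Fin D) (v : Fin (numNodes i.succ)), ∃ u, (label i u v).isSome
  exists_out : ∀ (i : Fin D) (u : Fin (numNodes i.castSucc)), ∃ v, (label i u v).isSome
  degree_lt : ∀ (i : Fin D) (u : Fin (numNodes i.castSucc)) (v : Fin (numNodes i.succ)),
    ∀ p ∈ label i u v, p.degree < (n : WithBot ℕ)

variable {F : Type*} [Field F] {D n : ℕ}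

/-- The width: the maximal number of vertices in a level. -/
def Branching.width (A : Branching F D n) : ℕ :=
  Finset.univ.sup A.numNodes

/-- The label of the edge from `u` to `v`, as a polynomial in all variables (`x_i` is substituted
for the variable of the label); it is `0` if there is no such edge. -/
def Branching.weight (A : Branching F D n) (i : Fin D)
    (u : Fin (A.numNodes i.castSucc)) (v : Fin (A.numNodes i.succ)) : MvPolynomial (Fin D) F :=
  match A.label i u v with
  | none => 0
  | some p => Polynomial.aeval (MvPolynomial.X i) p

/-- The polynomial computed by the program: the sum over all source-sink paths (one vertex in each
level) of the product of the labels along the path. A sequence of vertices that uses a missing edge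
contributes `0`. -/
def Branching.poly (A : Branching F D n) : MvPolynomial (Fin D) F :=
  ∑ q : (∀ i : Fin (D + 1), Fin (A.numNodes i)),
    ∏ i : Fin D, A.weight i (q i.castSucc) (q i.succ)

/-- The `D`-variate polynomials computable by read-once oblivious algebraic branching programs of
width at most `r`, depth `D` and individual degree `< n`. -/
def computable (F : Type*) [Field F] (r D n : ℕ) : Set (MvPolynomial (Fin D) F) :=
  {f | ∃ A : Branching F D n, A.width ≤ r ∧ A.poly = f}

/-- `H` is a hitting set for the class `C` of polynomials. -/
def IsHittingSet (H : Set (Fin D → F)) (C : Set (MvPolynomial (Fin D) F)) : Prop :=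
  ∀ f ∈ C, f = 0 ↔ ∀ a ∈ H, MvPolynomial.eval a f = 0

/-! ## Random access machines over a field

A machine has a memory of natural numbers and a memory of field elements. Operations on natural
numbers have logarithmic cost, field operations and equality tests in the field have unit cost (plus
the cost of the addresses involved), and the field is given by an enumeration of elements, whose
`k`-th element costs `k + 1`. Programs do not mention the field. -/

/-- `e 0, e 1, …` enumerates pairwise distinct elements of `F`: all elements if `F` is finite (the
values after the first `|F|` ones are irrelevant), infinitely many ones if `F` is infinite. -/
def IsEnumeration (e : ℕ → F) : Prop :=
  Set.InjOn e {k | (k : ℕ∞) < ENat.card F}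

/-- Operations on natural numbers: addition, truncated subtraction, multiplication, quotient and
remainder. -/
inductive NatOp where
  | add | sub | mul | div | mod

def NatOp.eval : NatOp → ℕ → ℕ → ℕ
  | .add, a, b => a + b
  | .sub, a, b => a - b
  | .mul, a, b => a * b
  | .div, a, b => a / b
  | .mod, a, b => a % b

/-- Operations of the field (`x / 0 = 0`). -/
inductive FieldOp where
  | add | sub | mul | div

def FieldOp.eval : FieldOp → F → F → F
  | .add, x, y => x + y
  | .sub, x, y => x - y
  | .mul, x, y => x * y
  | .div, x, y => x / y

/-- The contents of the two memories. -/
structure Memory (F : Type*) where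
  nat : ℕ → ℕ
  fld : ℕ → F

/-- Elementary instructions. With `N` the memory of naturals and `R` that of field elements:
`set d c` is `N[d] := c`; `op f d a b` is `N[d] := f(N[a], N[b])`; `load d a` is `N[d] := N[N[a]]`;
`store a b` is `N[N[a]] := N[b]`; `one d` is `R[N[d]] := 1`;
`fop f d a b` is `R[N[d]] := f(R[N[a]], R[N[b]])`; `enum d a` is `R[N[d]] := e(N[a])`. -/
inductive Instr where
  | set (d c : ℕ)
  | op (f : NatOp) (d a b : ℕ)
  | load (d a : ℕ)
  | store (a b : ℕ)
  | one (d : ℕ)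
  | fop (f : FieldOp) (d a b : ℕ)
  | enum (d a : ℕ)

/-- The effect of an instruction. -/
def Instr.run (e : ℕ → F) (s : Memory F) : Instr → Memory F
  | .set d c => { s with nat := Function.update s.nat d c }
  | .op f d a b => { s with nat := Function.update s.nat d (f.eval (s.nat a) (s.nat b)) }
  | .load d a => { s with nat := Function.update s.nat d (s.nat (s.nat a)) }
  | .store a b => { s with nat := Function.update s.nat (s.nat a) (s.nat b) }
  | .one d => { s with fld := Function.update s.fld (s.nat d) 1 }
  | .fop f d a b => { s with
      fld := Function.update s.fld (s.nat d) (f.eval (s.fld (s.nat a)) (s.fld (s.nat b))) }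
  | .enum d a => { s with fld := Function.update s.fld (s.nat d) (e (s.nat a)) }

/-- The cost of an instruction; `Nat.size` is the binary length. -/
def Instr.cost (s : Memory F) : Instr → ℕ
  | .set _ c => 1 + c.size
  | .op _ _ a b => 1 + (s.nat a).size + (s.nat b).size
  | .load _ a => 1 + (s.nat a).size + (s.nat (s.nat a)).size
  | .store a b => 1 + (s.nat a).size + (s.nat b).size
  | .one d => 1 + (s.nat d).size
  | .fop _ d a b => 1 + (s.nat d).size + (s.nat a).size + (s.nat b).size
  | .enum d a => 1 + (s.nat d).size + s.nat a

/-- Tests: `lt a b` is `N[a] < N[b]`, and `eq a b` is `R[N[a]] = R[N[b]]`. -/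
inductive Test where
  | lt (a b : ℕ)
  | eq (a b : ℕ)

def Test.Holds (s : Memory F) : Test → Prop
  | .lt a b => s.nat a < s.nat b
  | .eq a b => s.fld (s.nat a) = s.fld (s.nat b)

def Test.cost (s : Memory F) : Test → ℕ
  | .lt a b => 1 + (s.nat a).size + (s.nat b).size
  | .eq a b => 1 + (s.nat a).size + (s.nat b).size

/-- Programs: sequences, branches and loops of instructions. -/
inductive Program where
  | skip
  | instr (i : Instr)
  | seq (p q : Program)
  | cond (b : Test) (p q : Program)
  | loop (b : Test) (p : Program)

/-- `Exec e p s s' t`: the program `p`, started with memory `s`, halts with memory `s'` after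
running time `t`. -/
inductive Exec (e : ℕ → F) : Program → Memory F → Memory F → ℕ → Prop where
  | skip (s : Memory F) : Exec e .skip s s 1
  | instr (i : Instr) (s : Memory F) : Exec e (.instr i) s (i.run e s) (i.cost s)
  | seq {p q : Program} {s₁ s₂ s₃ : Memory F} {t₁ t₂ : ℕ} :
      Exec e p s₁ s₂ t₁ → Exec e q s₂ s₃ t₂ → Exec e (.seq p q) s₁ s₃ (t₁ + t₂)
  | cond_true {b : Test} {p q : Program} {s s' : Memory F} {t : ℕ} :
      b.Holds s → Exec e p s s' t → Exec e (.cond b p q) s s' (b.cost s + t)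
  | cond_false {b : Test} {p q : Program} {s s' : Memory F} {t : ℕ} :
      ¬ b.Holds s → Exec e q s s' t → Exec e (.cond b p q) s s' (b.cost s + t)
  | loop_true {b : Test} {p : Program} {s₁ s₂ s₃ : Memory F} {t₁ t₂ : ℕ} :
      b.Holds s₁ → Exec e p s₁ s₂ t₁ → Exec e (.loop b p) s₂ s₃ t₂ →
        Exec e (.loop b p) s₁ s₃ (b.cost s₁ + t₁ + t₂)
  | loop_false {b : Test} {p : Program} {s : Memory F} :
      ¬ b.Holds s → Exec e (.loop b p) s s (b.cost s)

/-- The initial memory: the input in the first cells, zeros elsewhere. -/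
def Memory.init (F : Type*) [Field F] (input : List ℕ) : Memory F where
  nat := fun i => input.getD i 0
  fld := fun _ => 0

/-- On the given input the program halts within time `T`, with the coordinates of the vector `a` in
the first cells of the memory of field elements. -/
def Program.OutputsWithin (p : Program) (e : ℕ → F) (input : List ℕ) (a : Fin D → F)
    (T : ℕ) : Prop :=
  ∃ (s : Memory F) (t : ℕ), Exec e p (Memory.init F input) s t ∧ t ≤ T ∧
    ∀ i : Fin D, s.fld i = a i

/-- The function `lg D / lg lg D`, which is defined and positive for `D ≥ 3`; it is taken to be `1`
for `D ≤ 2`. -/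
def lgDivLglg (D : ℕ) : ℝ :=
  if D ≤ 2 then 1 else Real.logb 2 D / Real.logb 2 (Real.logb 2 D)

end ROABP

end

noncomputable section

namespace ROABP

/-! ## Products over blocks and simultaneous spanning sets -/

/-! Padding every level to `r` vertices turns a branching program into a product of `D` matrices of
size `r × r`, each with entries in its own variable, and the computed polynomial into the sum of all
entries of the product. This sum is a linear functional on a space of dimension `r²`. So it suffices
to have `ρ ≥ r²` points whose matrix products span the products at all points: a functional that
vanishes at the former vanishes everywhere (`exists_eval_gen_ne_zero`).

Such points are built for blocks of `k ^ l` consecutive variables, by induction on `l`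
(`exists_seeds`). A block of level `l + 1` consists of `k` blocks of level `l`; products of spanning
sets span, so the `ρ ^ k` combinations of the old points suffice (`blockProd_mem_span`). A Lagrange
curve passes through all of them. Along it the matrix product is a polynomial of low degree in one
parameter, and its values are spanned by those at `ρ` parameters, the seeds. One greedy choice
serves all blocks at once (`exists_points_span`): a parameter fails to enlarge a deficient span only
if it is a root of a nonzero polynomial of low degree. Hence the seeds can be found among the first
`s = poly(D, n)` field elements.

With `k` about `lg D`, the number `ρ ^ k` of nodes is polynomial, and `L = clog k D`, about `lg D /
lg lg D`, levels cover all variables. The hitting set consists of the `ρ` points for all choices of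
`(L + 1) * ρ` seeds, so it has `ρ * s ^ ((L + 1) * ρ)` elements.

Coordinate `x` of the points of one level depends only on coordinate `x` of the points of the
previous level. A machine can therefore treat the coordinates one by one, keeping `ρ` values per
level (`tri_pointProg`). -/

/-- The ordered product `f lo * f (lo + 1) * ⋯ * f (lo + m - 1)`. -/
def blockProd {A : Type*} [Monoid A] (f : ℕ → A) (lo : ℕ) : ℕ → A
  | 0 => 1
  | m + 1 => blockProd f lo m * f (lo + m)

lemma blockProd_add {A : Type*} [Monoid A] (f : ℕ → A) (lo a b : ℕ) :
    blockProd f lo (a + b) = blockProd f lo a * blockProd f (lo + a) b := by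
  induction b with
  | zero => simp [blockProd]
  | succ b ih => rw [← add_assoc, blockProd, ih, blockProd, mul_assoc, add_assoc]

lemma blockProd_congr {A : Type*} [Monoid A] {f g : ℕ → A} {lo m : ℕ}
    (h : ∀ x, lo ≤ x → x < lo + m → f x = g x) : blockProd f lo m = blockProd g lo m := by
  induction m with
  | zero => rfl
  | succ m ih =>
    rw [blockProd, blockProd, ih fun x h1 h2 => h x h1 (by omega), h _ (by omega) (by omega)]

lemma map_blockProd {A B : Type*} [Monoid A] [Monoid B] (φ : A →* B) (f : ℕ → A) (lo m : ℕ) :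
    φ (blockProd f lo m) = blockProd (fun x => φ (f x)) lo m := by
  induction m with
  | zero => simp [blockProd]
  | succ m ih => simp [blockProd, ih]

/-- Points of a large finite set can be chosen such that the values of finitely many polynomial
maps of low degree at these points span all their values. -/
lemma exists_points_span {F V ι : Type*} [Field F] [AddCommGroup V] [Module F V]
    [FiniteDimensional F V] (s : Finset ι) (B : ι → F → V) (d : ℕ) (S : Finset F)
    (hB : ∀ b ∈ s, ∀ φ : Module.Dual F V, ∃ p : F[X], p.natDegree ≤ d ∧
      ∀ z, φ (B b z) = p.eval z)
    (hS : s.card * d < S.card) (t : ℕ) :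
    ∃ z : ℕ → F, (∀ i, z i ∈ S) ∧ ∀ b ∈ s,
      (∀ y, B b y ∈ Submodule.span F ((fun i => B b (z i)) '' Set.Iio t)) ∨
      t ≤ Module.finrank F (Submodule.span F ((fun i => B b (z i)) '' Set.Iio t)) := by
  classical
  induction t with
  | zero =>
    obtain ⟨x, hx⟩ : S.Nonempty := Finset.card_pos.1 (by omega)
    exact ⟨fun _ => x, fun _ => hx, fun b _ => Or.inr (Nat.zero_le _)⟩
  | succ t ih =>
    obtain ⟨z, hz, h⟩ := ih
    set U : ι → Submodule F V := fun b =>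
      Submodule.span F ((fun i => B b (z i)) '' Set.Iio t) with hU
    have key : ∀ b, ∃ p : F[X], b ∈ s → p ≠ 0 ∧ p.natDegree ≤ d ∧
        ((¬ ∀ y, B b y ∈ U b) → ∀ y, B b y ∈ U b → p.eval y = 0) := by
      intro b
      by_cases hb : b ∈ s
      swap
      · exact ⟨1, fun h => (hb h).elim⟩
      by_cases hall : ∀ y, B b y ∈ U b
      · exact ⟨1, fun _ => ⟨one_ne_zero, by simp, fun h => (h hall).elim⟩⟩
      · push Not at hall
        obtain ⟨y₀, hy₀⟩ := hall
        obtain ⟨φ, hφ, hker⟩ := Submodule.exists_le_ker_of_notMem hy₀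
        obtain ⟨p, hp, hpe⟩ := hB b hb φ
        refine ⟨p, fun _ => ⟨?_, hp, fun _ y hy => ?_⟩⟩
        · rintro rfl
          exact hφ (by rw [hpe]; simp)
        · rw [← hpe]
          exact hker hy
    choose p hp using key
    -- Union bound: some element of `S` enlarges all deficient spans simultaneously.
    have hcard : (s.biUnion fun b => (p b).roots.toFinset).card < S.card := by
      refine lt_of_le_of_lt (Finset.card_biUnion_le_card_mul _ _ d fun b hb => ?_) hS
      exact (Multiset.toFinset_card_le _).trans ((card_roots' _).trans (hp b hb).2.1)
    obtain ⟨y, hyS, hy⟩ := Finset.exists_mem_notMem_of_card_lt_card hcard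
    refine ⟨Function.update z t y, fun i => ?_, fun b hb => ?_⟩
    · by_cases hi : i = t
      · subst hi; simpa using hyS
      · simpa [Function.update_of_ne hi] using hz i
    · have hle : U b ≤ Submodule.span F
          ((fun i => B b (Function.update z t y i)) '' Set.Iio (t + 1)) := by
        refine Submodule.span_mono ?_
        rintro _ ⟨i, hi, rfl⟩
        have hi' : i < t := hi
        exact ⟨i, by simp only [Set.mem_Iio]; omega, by
          simp [Function.update_of_ne (show i ≠ t by omega)]⟩
      by_cases hall : ∀ y, B b y ∈ U b
      · exact Or.inl fun y => hle (hall y)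
      · right
        have hyU : B b y ∉ U b := by
          intro hmem
          apply hy
          rw [Finset.mem_biUnion]
          refine ⟨b, hb, ?_⟩
          rw [Multiset.mem_toFinset, mem_roots (hp b hb).1]
          exact (hp b hb).2.2 hall y hmem
        have hlt : U b < Submodule.span F
            ((fun i => B b (Function.update z t y i)) '' Set.Iio (t + 1)) := by
          refine lt_of_le_of_ne hle fun heq => hyU ?_
          rw [heq]
          exact Submodule.subset_span ⟨t, by simp, by simp⟩
        have h1 := Submodule.finrank_lt_finrank_of_lt hlt
        have h2 := (h b hb).resolve_left hall
        change t ≤ Module.finrank F (U b) at h2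
        omega

/-! ## The points -/

/-- The Lagrange basis polynomial of the nodes `e 0, …, e (R - 1)` that belongs to `e I`, at `z`. -/
def lag {F : Type*} [Field F] (e : ℕ → F) (R I : ℕ) (z : F) : F :=
  open Classical in
  ∏ J ∈ Finset.range R, if e J = e I then 1 else (z - e J) / (e I - e J)

/-- The coordinate `x` of the `i`-th point of level `l`, for the seeds `σ`. -/
def gen {F : Type*} [Field F] (e : ℕ → F) (σ : ℕ → ℕ) (ρ k R : ℕ) : ℕ → ℕ → ℕ → F
  | 0, i, _ => e (σ i)
  | l + 1, i, x => ∑ I ∈ Finset.range R,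
      lag e R I (e (σ ((l + 1) * ρ + i))) * gen e σ ρ k R l (I / ρ ^ ((x / k ^ l) % k) % ρ) x

section
variable {F : Type*} [Field F]

/-- Every index whose node equals `e I` contributes the factor `1`, so neither injectivity of `e`
nor `I < R` is needed. -/
lemma lag_self (e : ℕ → F) (R I : ℕ) : lag e R I (e I) = 1 := by
  classical
  refine Finset.prod_eq_one fun J _ => ?_
  split_ifs with h
  · rfl
  · exact div_self (sub_ne_zero.2 (Ne.symm h))

lemma lag_ne {e : ℕ → F} {R I K : ℕ} (hK : K < R) (h : e K ≠ e I) : lag e R I (e K) = 0 := by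
  classical
  refine Finset.prod_eq_zero (Finset.mem_range.2 hK) ?_
  simp [h]

/-- The degree bound is `R` and not `R - 1` because `e I` need not be one of the nodes. -/
lemma exists_lag_poly (e : ℕ → F) (R I : ℕ) :
    ∃ p : F[X], p.natDegree ≤ R ∧ ∀ z, p.eval z = lag e R I z := by
  classical
  refine ⟨∏ J ∈ Finset.range R, if e J = e I then 1 else
    (X - C (e J)) * C (e I - e J)⁻¹, ?_, fun z => ?_⟩
  · refine (natDegree_prod_le _ _).trans ?_
    refine (Finset.sum_le_card_nsmul _ _ 1 fun J _ => ?_).trans (by simp)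
    split_ifs
    · simp
    · exact (natDegree_mul_C_le _ _).trans (by simp)
  · rw [eval_prod, lag]
    refine Finset.prod_congr rfl fun J _ => ?_
    split_ifs
    · simp
    · simp [div_eq_mul_inv]

/-- Each level reads its own `ρ` seeds and, recursively, the earlier ones. Hence seeds can be
appended level by level, and finitely many of them fit into an index. -/
lemma gen_congr (e : ℕ → F) {σ σ' : ℕ → ℕ} (ρ k R l : ℕ) {i x : ℕ} (hi : i < ρ)
    (h : ∀ t < (l + 1) * ρ, σ t = σ' t) : gen e σ ρ k R l i x = gen e σ' ρ k R l i x := by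
  induction l generalizing i with
  | zero => simp only [gen]; rw [h i (by omega)]
  | succ l ih =>
    simp only [gen]
    refine Finset.sum_congr rfl fun I _ => ?_
    rw [h ((l + 1) * ρ + i) (by rw [add_mul (l + 1), one_mul]; omega),
      ih (Nat.mod_lt _ (by omega)) fun t ht => h t (by rw [add_mul (l + 1)]; omega)]

/-- In base `ρ` this numbers the combinations of points for `k` subblocks; in base `s` it packs the
seeds into an index. -/
lemma exists_digits (ρ : ℕ) (hρ : 0 < ρ) (τ : ℕ → ℕ) (hτ : ∀ j, τ j < ρ) (k : ℕ) :
    ∃ I < ρ ^ k, ∀ j < k, I / ρ ^ j % ρ = τ j := by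
  induction k with
  | zero => exact ⟨0, by simp, by simp⟩
  | succ k ih =>
    obtain ⟨I, hI, h⟩ := ih
    refine ⟨I + ρ ^ k * τ k, ?_, fun j hj => ?_⟩
    · calc I + ρ ^ k * τ k < ρ ^ k + ρ ^ k * τ k := by omega
        _ = ρ ^ k * (τ k + 1) := by ring
        _ ≤ ρ ^ k * ρ := Nat.mul_le_mul_left _ (hτ k)
        _ = ρ ^ (k + 1) := by ring
    · rcases Nat.lt_succ_iff_lt_or_eq.1 hj with hj | rfl
      · rw [← h j hj]
        obtain ⟨m, rfl⟩ : ∃ m, k = j + (m + 1) := ⟨k - j - 1, by omega⟩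
        rw [show ρ ^ (j + (m + 1)) * τ (j + (m + 1)) =
          ρ ^ j * (ρ * (ρ ^ m * τ (j + (m + 1)))) by ring,
          Nat.add_mul_div_left _ _ (pow_pos hρ j), Nat.add_mul_mod_self_left]
      · rw [Nat.add_mul_div_left _ _ (pow_pos hρ j), Nat.div_eq_of_lt hI, zero_add,
          Nat.mod_eq_of_lt (hτ j)]

/-- Evaluation of a matrix of polynomials. -/
def evalMat {r : ℕ} (z : F) : Matrix (Fin r) (Fin r) F[X] →+* Matrix (Fin r) (Fin r) F :=
  (evalRingHom z).mapMatrix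

/-- Products of elements of the spans of the values of subblocks. -/
lemma blockProd_mem_span {A : Type*} [Ring A] [Algebra F A] (f : ℕ → F → A) (ρ : ℕ)
    (hρ : 0 < ρ) (w : ℕ → ℕ → F) (v : ℕ → F) (m : ℕ) (hm : 0 < m) (b k : ℕ)
    (h : ∀ j < k, blockProd (fun x => f x (v x)) ((b * k + j) * m) m ∈
      Submodule.span F ((fun i => blockProd (fun x => f x (w i x)) ((b * k + j) * m) m) ''
        Set.Iio ρ)) (j : ℕ) (hj : j ≤ k) :
    blockProd (fun x => f x (v x)) (b * k * m) (j * m) ∈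
      Submodule.span F ((fun τ : ℕ → ℕ =>
        blockProd (fun x => f x (w (τ ((x / m) % k)) x)) (b * k * m) (j * m)) ''
          {τ | ∀ j, τ j < ρ}) := by
  induction j with
  | zero =>
    rw [zero_mul]
    exact Submodule.subset_span ⟨fun _ => 0, fun _ => hρ, rfl⟩
  | succ j ih =>
    rw [add_mul, one_mul, blockProd_add, ← add_mul]
    have := Submodule.mul_mem_mul (ih (by omega)) (h j (by omega))
    rw [Submodule.span_mul_span] at this
    refine Submodule.span_mono ?_ this
    rintro _ ⟨_, ⟨τ, hτ, rfl⟩, _, ⟨i, hi, rfl⟩, rfl⟩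
    refine ⟨Function.update τ j i, fun j' => ?_, ?_⟩
    · by_cases hj' : j' = j
      · subst hj'; simpa using hi
      · simpa [Function.update_of_ne hj'] using hτ j'
    · simp only
      rw [add_mul (b * k), blockProd_add]
      have hk : 0 < k := by omega
      congr 1
      · refine blockProd_congr fun x h1 h2 => ?_
        have h3 : x / m < b * k + j := (Nat.div_lt_iff_lt_mul hm).2 (by rw [add_mul]; omega)
        have h4 : b * k ≤ x / m := (Nat.le_div_iff_mul_le hm).2 h1
        obtain ⟨y, hy⟩ := Nat.exists_eq_add_of_le h4
        rw [hy, mul_comm b k, Nat.mul_add_mod, Nat.mod_eq_of_lt, Function.update_of_ne] <;> omega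
      · refine blockProd_congr fun x h1 h2 => ?_
        have h3 : x / m = b * k + j := by
          refine Nat.div_eq_of_lt_le (by rw [add_mul]; omega) ?_
          rw [add_mul, add_mul]; omega
        rw [h3, mul_comm b k, Nat.mul_add_mod, Nat.mod_eq_of_lt, Function.update_self]
        omega
end

/-! ### Existence of good seeds -/

section
variable {F : Type*} [Field F]

lemma natDegree_blockProd_le {r : ℕ} (f : ℕ → Matrix (Fin r) (Fin r) F[X]) (δ : ℕ → ℕ)
    (hf : ∀ x u v, (f x u v).natDegree ≤ δ x) (lo m : ℕ) (u v : Fin r) :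
    (blockProd f lo m u v).natDegree ≤ ∑ i ∈ Finset.range m, δ (lo + i) := by
  induction m generalizing u v with
  | zero =>
    rw [blockProd, Matrix.one_apply]
    split_ifs <;> simp
  | succ m ih =>
    rw [blockProd, Matrix.mul_apply, Finset.sum_range_succ]
    refine natDegree_sum_le_of_forall_le _ _ fun w _ => ?_
    exact natDegree_mul_le.trans (add_le_add (ih u w) (hf _ _ _))

/-- A functional is a linear combination of the matrix entries, so the composition inherits their
degree bound. -/
lemma exists_poly_dual_evalMat {r : ℕ} (B : Matrix (Fin r) (Fin r) F[X]) (d : ℕ)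
    (hB : ∀ u v, (B u v).natDegree ≤ d) (φ : Module.Dual F (Matrix (Fin r) (Fin r) F)) :
    ∃ p : F[X], p.natDegree ≤ d ∧ ∀ z, φ (evalMat z B) = p.eval z := by
  refine ⟨∑ u, ∑ v, C (φ (Matrix.single u v 1)) * B u v, ?_, fun z => ?_⟩
  · refine natDegree_sum_le_of_forall_le _ _ fun u _ =>
      natDegree_sum_le_of_forall_le _ _ fun v _ => ?_
    exact (natDegree_C_mul_le _ _).trans (hB u v)
  · conv_lhs => rw [Matrix.matrix_eq_sum_single (evalMat z B)]
    simp only [map_sum, eval_finsetSum, eval_mul, eval_C]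
    refine Finset.sum_congr rfl fun u _ => Finset.sum_congr rfl fun v _ => ?_
    rw [← mul_one (evalMat z B u v), ← smul_eq_mul, ← Matrix.smul_single, map_smul, smul_eq_mul,
      mul_comm]
    rfl

lemma evalMat_comp {r : ℕ} (B : Matrix (Fin r) (Fin r) F[X]) (c : F[X]) (z : F) :
    evalMat z ((compRingHom c).mapMatrix B) = evalMat (c.eval z) B := by
  ext u v
  simp [evalMat]

/-- Matrices beyond `D` are identities, so the degree of a block product is bounded independently of
its length. -/
lemma sum_ite_lt_le (D c lo m : ℕ) :
    ∑ i ∈ Finset.range m, (if lo + i < D then c else 0) ≤ D * c := by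
  rw [← Finset.sum_filter, Finset.sum_const, smul_eq_mul]
  refine Nat.mul_le_mul_right _ ?_
  rw [← Finset.card_range D]
  refine Finset.card_le_card fun i hi => ?_
  simp only [Finset.mem_filter, Finset.mem_range, Finset.card_range] at hi ⊢
  omega

lemma blockProd_evalMat_eq_one {r : ℕ} (M : ℕ → Matrix (Fin r) (Fin r) F[X]) (D : ℕ)
    (hM : ∀ x, D ≤ x → M x = 1) (lo m : ℕ) (hlo : D ≤ lo) (a : ℕ → F) :
    blockProd (fun x => evalMat (a x) (M x)) lo m = 1 := by
  induction m with
  | zero => rfl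
  | succ m ih => rw [blockProd, ih, hM _ (by omega), map_one, one_mul]

/-- Points for blocks from points for curves through blocks: one application of the greedy choice
to all blocks of length `m`. -/
lemma exists_seeds_blocks {r : ℕ} (M : ℕ → Matrix (Fin r) (Fin r) F[X]) (D m ρ n R s : ℕ)
    (hm : 0 < m) (hM : ∀ x, D ≤ x → M x = 1) (hdeg : ∀ x u v, (M x u v).natDegree ≤ n)
    (hρ : r * r ≤ ρ) (hρ0 : 0 < ρ) (e : ℕ → F) (he : Set.InjOn e (Set.Iio s))
    (hs : D * (D * (n * R)) < s) (c : ℕ → F[X]) (hc : ∀ x, (c x).natDegree ≤ R) :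
    ∃ τ : ℕ → ℕ, (∀ i, τ i < s) ∧ ∀ b (y : F),
      blockProd (fun x => evalMat ((c x).eval y) (M x)) (b * m) m ∈
        Submodule.span F ((fun i => blockProd
          (fun x => evalMat ((c x).eval (e (τ i))) (M x)) (b * m) m) '' Set.Iio ρ) := by
  classical
  set Q : ℕ → Matrix (Fin r) (Fin r) F[X] := fun b =>
    blockProd (fun x => (compRingHom (c x)).mapMatrix (M x)) (b * m) m with hQ
  have hQe : ∀ b z, evalMat z (Q b) =
      blockProd (fun x => evalMat ((c x).eval z) (M x)) (b * m) m := by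
    intro b z
    have := map_blockProd (evalMat z : _ →+* Matrix (Fin r) (Fin r) F).toMonoidHom
      (fun x => (compRingHom (c x)).mapMatrix (M x)) (b * m) m
    simp only [RingHom.toMonoidHom_eq_coe, MonoidHom.coe_coe, evalMat_comp] at this
    exact this
  have hQd : ∀ b u v, (Q b u v).natDegree ≤ D * (n * R) := by
    intro b u v
    refine (natDegree_blockProd_le _ (fun x => if x < D then n * R else 0)
      (fun x u v => ?_) _ _ u v).trans (sum_ite_lt_le _ _ _ _)
    split_ifs with hx
    · simp only [RingHom.mapMatrix_apply, Matrix.map_apply, coe_compRingHom_apply]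
      exact natDegree_comp_le.trans (Nat.mul_le_mul (hdeg _ _ _) (hc _))
    · rw [hM x (by omega), map_one, Matrix.one_apply]
      split_ifs <;> simp
  -- Only the blocks `b < D` matter: a later one starts at `b * m ≥ D` and is a product of
  -- identities.
  obtain ⟨z, hz, h⟩ := exists_points_span (Finset.range D) (fun b z => evalMat z (Q b))
    (D * (n * R)) ((Finset.range s).image e)
    (fun b _ φ => exists_poly_dual_evalMat (Q b) _ (hQd b) φ)
    (by
      rw [Finset.card_image_of_injOn (by simpa using he)]
      simpa using hs) ρ
  have hz' : ∀ i, ∃ t < s, e t = z i := fun i => by simpa using hz i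
  choose τ hτ hτz using hz'
  refine ⟨τ, hτ, fun b y => ?_⟩
  simp only [hτz, ← hQe]
  by_cases hb : b < D
  · rcases h b (by simpa using hb) with h | h
    · exact h y
    -- A subspace of dimension at least `ρ ≥ r * r` is the whole matrix space.
    · have : Submodule.span F ((fun i => evalMat (z i) (Q b)) '' Set.Iio ρ) = ⊤ := by
        refine Submodule.eq_top_of_finrank_eq (le_antisymm (Submodule.finrank_le _) ?_)
        refine le_trans ?_ h
        simpa [Module.finrank_matrix] using hρ
      rw [this]
      trivial
  · have hbm : D ≤ b * m := le_trans (by omega) (Nat.le_mul_of_pos_right b hm)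
    have h1 : ∀ z, evalMat z (Q b) = 1 := fun z => by
      rw [hQe]; exact blockProd_evalMat_eq_one M D hM _ _ hbm _
    rw [h1 y]
    exact Submodule.subset_span ⟨0, hρ0, h1 _⟩

/-- Good seeds: the products at the generated points span the products at all points. -/
lemma exists_seeds {r : ℕ} (M : ℕ → Matrix (Fin r) (Fin r) F[X]) (D ρ k n s : ℕ)
    (hM : ∀ x, D ≤ x → M x = 1) (hdeg : ∀ x u v, (M x u v).natDegree ≤ n)
    (hρ : r * r ≤ ρ) (hρ0 : 0 < ρ) (hk : 0 < k) (e : ℕ → F) (he : Set.InjOn e (Set.Iio s))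
    (hs : D * (D * (n * ρ ^ k)) < s) (hRs : ρ ^ k ≤ s) (l : ℕ) :
    ∃ σ : ℕ → ℕ, (∀ t, σ t < s) ∧ ∀ b (a : ℕ → F),
      blockProd (fun x => evalMat (a x) (M x)) (b * k ^ l) (k ^ l) ∈
        Submodule.span F ((fun i => blockProd
          (fun x => evalMat (gen e σ ρ k (ρ ^ k) l i x) (M x)) (b * k ^ l) (k ^ l)) ''
            Set.Iio ρ) := by
  induction l with
  | zero =>
    -- For blocks of length one the curve is the variable itself.
    obtain ⟨τ, hτ, h⟩ := exists_seeds_blocks M D 1 ρ n (ρ ^ k) s one_pos hM hdeg hρ hρ0 e he hs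
      (fun _ => X) (fun _ => by simpa using Nat.one_le_pow _ _ hρ0)
    refine ⟨τ, hτ, fun b a => ?_⟩
    have := h b (a b)
    simpa [gen, blockProd] using this
  | succ l ih =>
    obtain ⟨σ, hσ, h⟩ := ih
    choose p hpd hpe using fun I => exists_lag_poly e (ρ ^ k) I
    set m := k ^ l with hm
    have hm0 : 0 < m := pow_pos hk l
    -- The curve through all combinations: at the node `e I`, subblock `j` gets the old point given
    -- by the `j`-th digit of `I` in base `ρ`.
    set c : ℕ → F[X] := fun x => ∑ I ∈ Finset.range (ρ ^ k),
      p I * C (gen e σ ρ k (ρ ^ k) l (I / ρ ^ ((x / m) % k) % ρ) x) with hc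
    have hcd : ∀ x, (c x).natDegree ≤ ρ ^ k := fun x =>
      natDegree_sum_le_of_forall_le _ _ fun I _ => (natDegree_mul_C_le _ _).trans (hpd I)
    have hce : ∀ x z, (c x).eval z = ∑ I ∈ Finset.range (ρ ^ k),
        lag e (ρ ^ k) I z * gen e σ ρ k (ρ ^ k) l (I / ρ ^ ((x / m) % k) % ρ) x := by
      intro x z
      rw [hc, eval_finsetSum]
      simp [hpe]
    obtain ⟨τ, hτ, hτ'⟩ := exists_seeds_blocks M D (k ^ (l + 1)) ρ n (ρ ^ k) s (pow_pos hk _) hM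
      hdeg hρ hρ0 e he hs c hcd
    set σ' : ℕ → ℕ := fun t => if t < (l + 1) * ρ then σ t else τ (t - (l + 1) * ρ) with hσ'
    refine ⟨σ', fun t => ?_, fun b a => ?_⟩
    · simp only [hσ']
      split_ifs
      exacts [hσ t, hτ _]
    have hgen : ∀ i < ρ, ∀ x, gen e σ' ρ k (ρ ^ k) (l + 1) i x = (c x).eval (e (τ i)) := by
      intro i hi x
      rw [hce, gen]
      refine Finset.sum_congr rfl fun I _ => ?_
      rw [gen_congr e (σ := σ') (σ' := σ) ρ k _ l (Nat.mod_lt _ hρ0)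
        fun t ht => by simp [hσ', ht]]
      simp [hσ', hm]
    have himg : (fun i => blockProd (fun x => evalMat (gen e σ' ρ k (ρ ^ k) (l + 1) i x) (M x))
          (b * k ^ (l + 1)) (k ^ (l + 1))) '' Set.Iio ρ =
        (fun i => blockProd (fun x => evalMat ((c x).eval (e (τ i))) (M x))
          (b * k ^ (l + 1)) (k ^ (l + 1))) '' Set.Iio ρ := by
      refine Set.image_congr fun i hi => ?_
      simp only [hgen i hi]
    rw [himg]
    have h1 := blockProd_mem_span (fun x z => evalMat z (M x)) ρ hρ0
      (fun i x => gen e σ ρ k (ρ ^ k) l i x) a m hm0 b k (fun j _ => h (b * k + j) a) k le_rfl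
    have hpow : k ^ (l + 1) = k * m := by rw [pow_succ, mul_comm]
    rw [show b * k * m = b * k ^ (l + 1) by rw [hpow, mul_assoc], ← hpow] at h1
    refine Submodule.span_le.2 ?_ h1
    rintro _ ⟨ν, hν, rfl⟩
    -- The combination `ν` is the point of the curve at the node `e I`, so its product lies in the
    -- span of the products at the new seeds.
    obtain ⟨I, hI, hIν⟩ := exists_digits ρ hρ0 ν hν k
    have h2 := hτ' b (e I)
    have h3 : (fun x => evalMat ((c x).eval (e I)) (M x)) =
        fun x => evalMat (gen e σ ρ k (ρ ^ k) l (ν ((x / m) % k)) x) (M x) := by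
      funext x
      rw [hce, Finset.sum_eq_single I]
      · rw [lag_self, one_mul, hIν _ (Nat.mod_lt _ hk)]
      · intro J hJ hne
        rw [lag_ne hI, zero_mul]
        intro heq
        exact hne (he (by simpa using (Finset.mem_range.1 hJ).trans_le hRs)
          (by simpa using hI.trans_le hRs) heq.symm)
      · intro hI'
        exact (hI' (Finset.mem_range.2 hI)).elim
    rw [h3] at h2
    exact h2
end

/-! ### From branching programs to matrix products -/

section
variable {F : Type*} [Field F]

/-- The end weight `g` serves the induction: removing the last vertex replaces `g` by its image
under the last matrix. -/
lemma sum_paths {r : ℕ} (M : ℕ → Matrix (Fin r) (Fin r) F) (D : ℕ) (g : Fin r → F) :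
    ∑ q : Fin (D + 1) → Fin r, (∏ i : Fin D, M i (q i.castSucc) (q i.succ)) * g (q (Fin.last D)) =
      ∑ u, ∑ v, blockProd M 0 D u v * g v := by
  induction D generalizing g with
  | zero =>
    rw [← (Equiv.funUnique (Fin 1) (Fin r)).symm.sum_comp]
    simp [blockProd, Matrix.one_apply]
  | succ D ih =>
    rw [← (Fin.snocEquiv fun _ => Fin r).sum_comp, Fintype.sum_prod_type_right]
    have h1 : ∀ q : Fin (D + 1) → Fin r, ∑ w : Fin r,
        (∏ i : Fin (D + 1), M i ((Fin.snocEquiv fun _ => Fin r) (w, q) i.castSucc)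
          ((Fin.snocEquiv fun _ => Fin r) (w, q) i.succ)) *
            g ((Fin.snocEquiv fun _ => Fin r) (w, q) (Fin.last (D + 1))) =
        (∏ i : Fin D, M i (q i.castSucc) (q i.succ)) *
          ∑ w, M D (q (Fin.last D)) w * g w := by
      intro q
      rw [Finset.mul_sum]
      refine Finset.sum_congr rfl fun w _ => ?_
      rw [Fin.prod_univ_castSucc]
      simp only [Fin.snocEquiv_apply, Fin.snoc_castSucc, Fin.val_castSucc, Fin.succ_castSucc,
        Fin.succ_last, Fin.snoc_last, Fin.val_last]
      ring
    refine (Finset.sum_congr rfl fun q _ => h1 q).trans ?_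
    rw [ih fun u => ∑ w, M D u w * g w]
    refine Finset.sum_congr rfl fun u _ => ?_
    simp only [blockProd, zero_add, Matrix.mul_apply, Finset.sum_mul, Finset.mul_sum]
    rw [Finset.sum_comm]
    simp only [mul_assoc]

variable {D n : ℕ}

/-- The label of a pair of vertices, `0` if there is no edge. -/
def Branching.labelPoly (A : Branching F D n) (i : Fin D)
    (u : Fin (A.numNodes i.castSucc)) (v : Fin (A.numNodes i.succ)) : F[X] :=
  (A.label i u v).getD 0

lemma Branching.weight_eq (A : Branching F D n) (i : Fin D)
    (u : Fin (A.numNodes i.castSucc)) (v : Fin (A.numNodes i.succ)) :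
    A.weight i u v = Polynomial.aeval (MvPolynomial.X i) (A.labelPoly i u v) := by
  unfold Branching.weight Branching.labelPoly
  cases A.label i u v <;> simp

lemma Branching.natDegree_labelPoly (A : Branching F D n) (i : Fin D)
    (u : Fin (A.numNodes i.castSucc)) (v : Fin (A.numNodes i.succ)) :
    (A.labelPoly i u v).natDegree ≤ n := by
  have := A.degree_lt i u v
  unfold Branching.labelPoly
  cases h : A.label i u v with
  | none => simp
  | some p => exact natDegree_le_of_degree_le (this p (by simp [h])).le

/-- The matrices of labels, padded to the size `r`, and continued by the identity matrix. -/
def Branching.matrix (A : Branching F D n) (r x : ℕ) : Matrix (Fin r) (Fin r) F[X] :=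
  if hx : x < D then Matrix.of fun u v =>
    if h : (u : ℕ) < A.numNodes (Fin.castSucc ⟨x, hx⟩) ∧ (v : ℕ) < A.numNodes (Fin.succ ⟨x, hx⟩)
    then A.labelPoly ⟨x, hx⟩ ⟨u, h.1⟩ ⟨v, h.2⟩ else 0
  else 1

lemma Branching.matrix_apply (A : Branching F D n) (r : ℕ) (j : Fin D) (u v : Fin r) :
    A.matrix r j u v =
      if h : (u : ℕ) < A.numNodes j.castSucc ∧ (v : ℕ) < A.numNodes j.succ
      then A.labelPoly j ⟨u, h.1⟩ ⟨v, h.2⟩ else 0 := by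
  simp [Branching.matrix]

lemma Branching.matrix_of_le (A : Branching F D n) (r : ℕ) {x : ℕ} (hx : D ≤ x) :
    A.matrix r x = 1 := by
  simp [Branching.matrix, Nat.not_lt.2 hx]

lemma Branching.matrix_natDegree (A : Branching F D n) (r x : ℕ) (u v : Fin r) :
    (A.matrix r x u v).natDegree ≤ n := by
  by_cases hx : x < D
  · have := A.matrix_apply r ⟨x, hx⟩ u v
    simp only at this
    rw [this]
    split_ifs
    · exact A.natDegree_labelPoly _ _ _
    · simp
  · rw [A.matrix_of_le r (not_lt.1 hx), Matrix.one_apply]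
    split_ifs <;> simp

/-- Sequences through padding vertices meet a zero entry, so only genuine paths contribute. For `D =
0` the formula fails: the program computes `1`, while the entries of the identity sum to `r`. -/
lemma Branching.eval_poly (A : Branching F D n) (r : ℕ) (hr : A.width ≤ r) (hD : 0 < D)
    (a : ℕ → F) :
    MvPolynomial.eval (fun i : Fin D => a i) A.poly =
      ∑ u, ∑ v, blockProd (fun x => evalMat (a x) (A.matrix r x)) 0 D u v := by
  have hw : ∀ i, A.numNodes i ≤ r := fun i => (Finset.le_sup (Finset.mem_univ i)).trans hr
  have h1 := sum_paths (fun x => evalMat (a x) (A.matrix r x)) D fun _ => 1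
  simp only [mul_one] at h1
  rw [← h1, Branching.poly, map_sum]
  refine Fintype.sum_of_injective (fun q i => Fin.castLE (hw i) (q i)) ?_ _ _ ?_ ?_
  · intro q q' h
    funext i
    exact Fin.castLE_injective _ (congrFun h i)
  · intro q hq
    have : ∃ i, A.numNodes i ≤ q i := by
      by_contra! hcon
      exact hq ⟨fun i => ⟨q i, hcon i⟩, rfl⟩
    obtain ⟨i, hi⟩ := this
    have hzero : ∀ j : Fin D, (i = j.castSucc ∨ i = j.succ) →
        evalMat (a j) (A.matrix r j) (q j.castSucc) (q j.succ) = 0 := by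
      intro j hj
      have : A.matrix r j (q j.castSucc) (q j.succ) = 0 := by
        rw [A.matrix_apply, dif_neg]
        rintro ⟨h1, h2⟩
        rcases hj with rfl | rfl <;> omega
      simp [evalMat, this]
    -- A padding vertex kills the edge that leaves it or, on the last level, the edge that enters
    -- it.
    by_cases hil : i = Fin.last D
    · obtain ⟨D', rfl⟩ : ∃ D', D = D' + 1 := ⟨D - 1, by omega⟩
      exact Finset.prod_eq_zero (Finset.mem_univ (Fin.last D'))
        (hzero _ (Or.inr (by rw [hil, Fin.succ_last])))
    · refine Finset.prod_eq_zero (Finset.mem_univ (i.castPred hil)) (hzero _ (Or.inl ?_))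
      simp
  · intro q
    rw [map_prod]
    refine Finset.prod_congr rfl fun i _ => ?_
    rw [A.weight_eq]
    have hM : A.matrix r i (Fin.castLE (hw _) (q i.castSucc)) (Fin.castLE (hw _) (q i.succ)) =
        A.labelPoly i (q i.castSucc) (q i.succ) := by
      simp [A.matrix_apply]
    simp only [evalMat, RingHom.mapMatrix_apply, Matrix.map_apply, hM, coe_evalRingHom]
    rw [← MvPolynomial.coe_aeval_eq_eval, RingHom.coe_coe, ← Polynomial.aeval_algHom_apply]
    simp [Polynomial.coe_aeval_eq_eval]

lemma Branching.degreeOf_poly_le (A : Branching F D n) (i : Fin D) :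
    A.poly.degreeOf i ≤ D * n := by
  refine (MvPolynomial.degreeOf_le_totalDegree _ _).trans ?_
  refine MvPolynomial.totalDegree_finsetSum_le fun q _ => ?_
  refine (MvPolynomial.totalDegree_finsetProd _ _).trans ?_
  refine (Finset.sum_le_card_nsmul _ _ n fun j _ => ?_).trans (by simp)
  rw [A.weight_eq, Polynomial.aeval_eq_sum_range]
  refine MvPolynomial.totalDegree_finsetSum_le fun t ht => ?_
  refine (MvPolynomial.totalDegree_smul_le _ _).trans ?_
  refine (MvPolynomial.totalDegree_pow _ _).trans ?_
  rw [MvPolynomial.totalDegree_X, mul_one]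
  have := A.natDegree_labelPoly j (q j.castSucc) (q j.succ)
  have := Finset.mem_range.1 ht
  omega

/-- For a nonzero computable polynomial one of the generated points is a nonzero. -/
theorem exists_eval_gen_ne_zero (r ρ k s L : ℕ) (hρ : r * r ≤ ρ) (hρ0 : 0 < ρ) (hk : 0 < k)
    (hL : D ≤ k ^ L) (e : ℕ → F) (he : Set.InjOn e (Set.Iio s))
    (hs : D * (D * (n * ρ ^ k)) < s) (hRs : ρ ^ k ≤ s) (hDn : D * n < s)
    {f : MvPolynomial (Fin D) F} (hf : f ∈ computable F r D n) (hf0 : f ≠ 0) :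
    ∃ σ : ℕ → ℕ, (∀ t, σ t < s) ∧ ∃ i < ρ,
      MvPolynomial.eval (fun x : Fin D => gen e σ ρ k (ρ ^ k) L i x) f ≠ 0 := by
  classical
  obtain ⟨A, hA, rfl⟩ := hf
  have hs0 : 0 < s := by omega
  rcases Nat.eq_zero_or_pos D with rfl | hD
  · refine ⟨fun _ => 0, fun _ => hs0, 0, hρ0, fun h0 => hf0 ?_⟩
    rw [MvPolynomial.eq_C_of_isEmpty A.poly] at h0 ⊢
    rw [MvPolynomial.eval_C] at h0
    rw [h0, map_zero]
  have hM : ∀ x, D ≤ x → A.matrix r x = 1 := fun x => A.matrix_of_le r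
  obtain ⟨σ, hσ, h⟩ := exists_seeds (A.matrix r) D ρ k n s hM (A.matrix_natDegree r) hρ hρ0 hk e
    he hs hRs L
  refine ⟨σ, hσ, ?_⟩
  by_contra! hcon
  apply hf0
  -- The degree in each variable is below `s`, so vanishing on the grid of the first `s` enumerated
  -- elements suffices.
  refine MvPolynomial.eq_zero_of_eval_zero_at_prod_finset _ (fun _ => (Finset.range s).image e)
    (fun i => ?_) fun y _ => ?_
  · rw [Finset.card_image_of_injOn (by simpa using he), Finset.card_range]
    exact (A.degreeOf_poly_le i).trans_lt hDn
  have hfull : ∀ a : ℕ → F, MvPolynomial.eval (fun i : Fin D => a i) A.poly =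
      ∑ u, ∑ v, blockProd (fun x => evalMat (a x) (A.matrix r x)) 0 (k ^ L) u v := by
    intro a
    -- Identity matrices extend the product from length `D` to `k ^ L`.
    rw [A.eval_poly r hA hD, show k ^ L = D + (k ^ L - D) by omega, blockProd_add,
      blockProd_evalMat_eq_one _ D hM (0 + D) _ (by omega), mul_one]
  set φ : Matrix (Fin r) (Fin r) F →ₗ[F] F := ∑ u, ∑ v, Matrix.entryLinearMap F F u v with hφ
  have hφe : ∀ B, φ B = ∑ u, ∑ v, B u v := fun B => by simp [hφ, LinearMap.sum_apply]
  set y' : ℕ → F := fun x => if hx : x < D then y ⟨x, hx⟩ else 0 with hy'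
  have hyy : y = fun i : Fin D => y' i := by
    funext i
    simp [hy']
  rw [hyy, hfull, ← hφe]
  have h2 := h 0 y'
  rw [zero_mul] at h2
  have hle : Submodule.span F ((fun i => blockProd
      (fun x => evalMat (gen e σ ρ k (ρ ^ k) L i x) (A.matrix r x)) 0 (k ^ L)) '' Set.Iio ρ) ≤
      LinearMap.ker φ := by
    refine Submodule.span_le.2 ?_
    rintro _ ⟨i, hi, rfl⟩
    rw [SetLike.mem_coe, LinearMap.mem_ker, hφe, ← hfull]
    exact hcon i hi
  exact hle h2
end

/-! ## Reasoning about programs -/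

section
variable {F : Type*} [Field F]

/-- The program `p` halts on `s`, within time `w * τ`, in a memory with the property `Q`. -/
def Tri (e : ℕ → F) (w : ℕ) (p : Program) (s : Memory F) (τ : ℕ) (Q : Memory F → Prop) : Prop :=
  ∃ (s' : Memory F) (t : ℕ), Exec e p s s' t ∧ t ≤ w * τ ∧ Q s'

variable {e : ℕ → F} {w : ℕ}

lemma Tri.mono {p : Program} {s : Memory F} {τ τ' : ℕ} {Q Q' : Memory F → Prop}
    (h : Tri e w p s τ Q) (hτ : τ ≤ τ') (hQ : ∀ s, Q s → Q' s) : Tri e w p s τ' Q' := by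
  obtain ⟨s', t, h1, h2, h3⟩ := h
  exact ⟨s', t, h1, h2.trans (Nat.mul_le_mul_left _ hτ), hQ _ h3⟩

lemma Tri.seq {p q : Program} {s : Memory F} {τ₁ τ₂ : ℕ} {Q R : Memory F → Prop}
    (h : Tri e w p s τ₁ R) (h' : ∀ s', R s' → Tri e w q s' τ₂ Q) :
    Tri e w (.seq p q) s (τ₁ + τ₂) Q := by
  obtain ⟨s₁, t₁, a1, a2, a3⟩ := h
  obtain ⟨s₂, t₂, b1, b2, b3⟩ := h' s₁ a3
  exact ⟨s₂, t₁ + t₂, .seq a1 b1, by rw [mul_add]; omega, b3⟩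

lemma Tri.skip {s : Memory F} {Q : Memory F → Prop} (hw : 1 ≤ w) (h : Q s) :
    Tri e w .skip s 1 Q := ⟨s, 1, .skip s, by omega, h⟩

lemma Tri.cond {b : Test} {p q : Program} {s : Memory F} {τ : ℕ} {Q : Memory F → Prop}
    (hc : b.cost s ≤ w) (hp : b.Holds s → Tri e w p s τ Q) (hq : ¬ b.Holds s → Tri e w q s τ Q) :
    Tri e w (.cond b p q) s (τ + 1) Q := by
  by_cases hb : b.Holds s
  · obtain ⟨s', t, h1, h2, h3⟩ := hp hb
    exact ⟨s', _, .cond_true hb h1, by rw [mul_add]; omega, h3⟩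
  · obtain ⟨s', t, h1, h2, h3⟩ := hq hb
    exact ⟨s', _, .cond_false hb h1, by rw [mul_add]; omega, h3⟩

/-- The invariant is indexed by the number of completed rounds, and `m` is the exact number of
rounds; the final failing test accounts for the `+ 1`. -/
lemma Tri.loop {b : Test} {p : Program} (Inv : ℕ → Memory F → Prop) {m τ : ℕ}
    (hc : ∀ i ≤ m, ∀ s, Inv i s → b.cost s ≤ w)
    (hb : ∀ i ≤ m, ∀ s, Inv i s → (b.Holds s ↔ i < m))
    (hp : ∀ i < m, ∀ s, Inv i s → Tri e w p s τ (Inv (i + 1))) {s : Memory F} (hs : Inv 0 s) :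
    Tri e w (.loop b p) s (m * (τ + 1) + 1) (Inv m) := by
  have key : ∀ d i s, i + d = m → Inv i s → Tri e w (.loop b p) s (d * (τ + 1) + 1) (Inv m) := by
    intro d
    induction d with
    | zero =>
      intro i s hi hs
      obtain rfl : i = m := by omega
      exact ⟨s, _, .loop_false (by rw [hb i le_rfl s hs]; omega),
        by simpa using hc i le_rfl s hs, hs⟩
    | succ d ih =>
      intro i s hi hs
      obtain ⟨s₁, t₁, a1, a2, a3⟩ := hp i (by omega) s hs
      obtain ⟨s₂, t₂, b1, b2, b3⟩ := ih (i + 1) s₁ (by omega) a3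
      refine ⟨s₂, _, .loop_true ((hb i (by omega) s hs).2 (by omega)) a1 b1, ?_, b3⟩
      have := hc i (by omega) s hs
      calc b.cost s + t₁ + t₂ ≤ w + w * τ + w * (d * (τ + 1) + 1) := by omega
        _ = w * ((d + 1) * (τ + 1) + 1) := by ring
  exact key m 0 s (by omega) hs

/-- A list of instructions, followed by a program. -/
def instrs : List Instr → Program → Program
  | [], p => p
  | i :: l, p => .seq (.instr i) (instrs l p)

/-- The list with the entry at `d` replaced; it is filled up by zeros. -/
def upd : List ℕ → ℕ → ℕ → List ℕ
  | [], 0, v => [v]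
  | [], d + 1, v => 0 :: upd [] d v
  | _ :: l, 0, v => v :: l
  | x :: l, d + 1, v => x :: upd l d v

/-- The entry at `i`, `0` beyond the end of the list. -/
def rd (l : List ℕ) (i : ℕ) : ℕ := l.getD i 0

lemma rd_upd (l : List ℕ) (d v : ℕ) : rd (upd l d v) = Function.update (rd l) d v := by
  funext i
  induction d generalizing l i with
  | zero =>
    cases l <;> cases i <;> simp [upd, rd]
  | succ d ih =>
    cases l with
    | nil =>
      cases i with
      | zero => simp [upd, rd]
      | succ i =>
        have := ih [] i
        simp only [rd] at this
        simp only [upd, rd, List.getD_cons_succ, this]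
        simp [Function.update_apply, rd]
    | cons y l =>
      cases i with
      | zero => simp [upd, rd]
      | succ i =>
        have := ih l i
        simp only [rd] at this
        simp only [upd, rd, List.getD_cons_succ, this]
        simp [Function.update_apply, rd]

/-- The memory with the natural numbers `l` and the field elements `g`. -/
def mem (l : List ℕ) (g : ℕ → F) : Memory F := ⟨rd l, g⟩

/-- Bounds for the cost of single instructions: `B` bounds the natural numbers that occur and `E`
the indices of the elements of the field that are generated. -/
structure Costs (B E w : ℕ) : Prop where
  size : ∀ v ≤ B, 3 * v.size + 1 ≤ w
  enum : ∀ v ≤ B, ∀ a ≤ E, 1 + v.size + a ≤ w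

variable {B E : ℕ}

lemma tri_instrs_nil {p : Program} {s : Memory F} {τ : ℕ} {Q : Memory F → Prop}
    (h : Tri e w p s τ Q) : Tri e w (instrs [] p) s τ Q := h

lemma tri_instr {i : Instr} {is : List Instr} {p : Program} {s s' : Memory F} {τ : ℕ}
    {Q : Memory F → Prop} (hs : i.run e s = s') (hc : i.cost s ≤ w)
    (h : Tri e w (instrs is p) s' τ Q) : Tri e w (instrs (i :: is) p) s (τ + 1) Q := by
  subst hs
  rw [add_comm]
  exact Tri.seq (R := fun s' => s' = i.run e s) ⟨_, _, .instr i s, by simpa using hc, rfl⟩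
    (by rintro _ rfl; exact h)

variable {is : List Instr} {p : Program} {l : List ℕ} {g : ℕ → F} {τ : ℕ} {Q : Memory F → Prop}

lemma tri_set (H : Costs B E w) {d c : ℕ} (hc : c ≤ B)
    (h : Tri e w (instrs is p) (mem (upd l d c) g) τ Q) :
    Tri e w (instrs (.set d c :: is) p) (mem l g) (τ + 1) Q := by
  refine tri_instr ?_ ?_ h
  · simp [Instr.run, mem, rd_upd]
  · have := H.size c hc
    simp only [Instr.cost]; omega

lemma tri_op (H : Costs B E w) {f : NatOp} {d a b : ℕ} (ha : rd l a ≤ B) (hb : rd l b ≤ B)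
    (h : Tri e w (instrs is p) (mem (upd l d (f.eval (rd l a) (rd l b))) g) τ Q) :
    Tri e w (instrs (.op f d a b :: is) p) (mem l g) (τ + 1) Q := by
  refine tri_instr ?_ ?_ h
  · simp [Instr.run, mem, rd_upd]
  · have := H.size _ ha
    have := H.size _ hb
    simp only [Instr.cost, mem]; omega

lemma tri_one (H : Costs B E w) {d : ℕ} (hd : rd l d ≤ B)
    (h : Tri e w (instrs is p) (mem l (Function.update g (rd l d) 1)) τ Q) :
    Tri e w (instrs (.one d :: is) p) (mem l g) (τ + 1) Q := by
  refine tri_instr rfl ?_ h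
  have := H.size _ hd
  simp only [Instr.cost, mem]; omega

lemma tri_fop (H : Costs B E w) {f : FieldOp} {d a b : ℕ} (hd : rd l d ≤ B)
    (ha : rd l a ≤ B) (hb : rd l b ≤ B)
    (h : Tri e w (instrs is p) (mem l (Function.update g (rd l d)
      (f.eval (g (rd l a)) (g (rd l b))))) τ Q) :
    Tri e w (instrs (.fop f d a b :: is) p) (mem l g) (τ + 1) Q := by
  refine tri_instr rfl ?_ h
  have := H.size _ hd
  have := H.size _ ha
  have := H.size _ hb
  simp only [Instr.cost, mem]; omega

/-- Here alone the cost is linear in a value and not in its bit length, hence the separate bound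
`E`. -/
lemma tri_enum (H : Costs B E w) {d a : ℕ} (hd : rd l d ≤ B) (ha : rd l a ≤ E)
    (h : Tri e w (instrs is p) (mem l (Function.update g (rd l d) (e (rd l a)))) τ Q) :
    Tri e w (instrs (.enum d a :: is) p) (mem l g) (τ + 1) Q := by
  refine tri_instr rfl ?_ h
  have := H.enum _ hd _ ha
  simp only [Instr.cost, mem]; omega

lemma tri_instrs_skip (H : Costs B E w) (h : Q (mem l g)) :
    Tri e w (instrs [] .skip) (mem l g) 1 Q :=
  Tri.skip (by have := H.size 0 (Nat.zero_le _); omega) h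

omit [Field F] in
lemma cost_lt_le (H : Costs B E w) {a b : ℕ} (ha : rd l a ≤ B) (hb : rd l b ≤ B) :
    (Test.lt a b).cost (mem l g) ≤ w := by
  have := H.size _ ha
  have := H.size _ hb
  simp only [Test.cost, mem]; omega

omit [Field F] in
lemma cost_eq_le (H : Costs B E w) {a b : ℕ} (ha : rd l a ≤ B) (hb : rd l b ≤ B) :
    (Test.eq a b).cost (mem l g) ≤ w := by
  have := H.size _ ha
  have := H.size _ hb
  simp only [Test.cost, mem]; omega

end

/-! ## The program -/

/-- The constants of the computation. -/
structure Consts where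
  (D n κ k R s o ρ : ℕ)

/-- The contents of the memory of natural numbers. -/
def cfg (c : Consts) (x q m P i I J t a : ℕ) : List ℕ :=
  [c.D, c.n, c.κ, c.k, c.R, c.s, c.o, x, q, m, P, i, I, J, t, a, c.D + 2 * c.ρ, c.D + 2 * c.ρ + 1,
    c.D + 2 * c.ρ + 2, c.D + 2 * c.ρ + 3, c.D + 2 * c.ρ + 4, 1, c.ρ, 0, c.D + c.ρ]

section cfg
variable (c : Consts) (x q m P i I J t a v : ℕ)
-- As simp lemmas, these execute instructions symbolically: a write to a working cell changes one
-- argument of `cfg`.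
lemma cfg_upd7 : upd (cfg c x q m P i I J t a) 7 v = cfg c v q m P i I J t a := rfl
lemma cfg_upd8 : upd (cfg c x q m P i I J t a) 8 v = cfg c x v m P i I J t a := rfl
lemma cfg_upd9 : upd (cfg c x q m P i I J t a) 9 v = cfg c x q v P i I J t a := rfl
lemma cfg_upd10 : upd (cfg c x q m P i I J t a) 10 v = cfg c x q m v i I J t a := rfl
lemma cfg_upd11 : upd (cfg c x q m P i I J t a) 11 v = cfg c x q m P v I J t a := rfl
lemma cfg_upd12 : upd (cfg c x q m P i I J t a) 12 v = cfg c x q m P i v J t a := rfl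
lemma cfg_upd13 : upd (cfg c x q m P i I J t a) 13 v = cfg c x q m P i I v t a := rfl
lemma cfg_upd14 : upd (cfg c x q m P i I J t a) 14 v = cfg c x q m P i I J v a := rfl
lemma cfg_upd15 : upd (cfg c x q m P i I J t a) 15 v = cfg c x q m P i I J t v := rfl
lemma cfg_0 : rd (cfg c x q m P i I J t a) 0 = c.D := rfl
lemma cfg_1 : rd (cfg c x q m P i I J t a) 1 = c.n := rfl
lemma cfg_2 : rd (cfg c x q m P i I J t a) 2 = c.κ := rfl
lemma cfg_3 : rd (cfg c x q m P i I J t a) 3 = c.k := rfl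
lemma cfg_4 : rd (cfg c x q m P i I J t a) 4 = c.R := rfl
lemma cfg_5 : rd (cfg c x q m P i I J t a) 5 = c.s := rfl
lemma cfg_6 : rd (cfg c x q m P i I J t a) 6 = c.o := rfl
lemma cfg_7 : rd (cfg c x q m P i I J t a) 7 = x := rfl
lemma cfg_8 : rd (cfg c x q m P i I J t a) 8 = q := rfl
lemma cfg_9 : rd (cfg c x q m P i I J t a) 9 = m := rfl
lemma cfg_10 : rd (cfg c x q m P i I J t a) 10 = P := rfl
lemma cfg_11 : rd (cfg c x q m P i I J t a) 11 = i := rfl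
lemma cfg_12 : rd (cfg c x q m P i I J t a) 12 = I := rfl
lemma cfg_13 : rd (cfg c x q m P i I J t a) 13 = J := rfl
lemma cfg_14 : rd (cfg c x q m P i I J t a) 14 = t := rfl
lemma cfg_15 : rd (cfg c x q m P i I J t a) 15 = a := rfl
lemma cfg_16 : rd (cfg c x q m P i I J t a) 16 = c.D + 2 * c.ρ := rfl
lemma cfg_17 : rd (cfg c x q m P i I J t a) 17 = c.D + 2 * c.ρ + 1 := rfl
lemma cfg_18 : rd (cfg c x q m P i I J t a) 18 = c.D + 2 * c.ρ + 2 := rfl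
lemma cfg_19 : rd (cfg c x q m P i I J t a) 19 = c.D + 2 * c.ρ + 3 := rfl
lemma cfg_20 : rd (cfg c x q m P i I J t a) 20 = c.D + 2 * c.ρ + 4 := rfl
lemma cfg_21 : rd (cfg c x q m P i I J t a) 21 = 1 := rfl
lemma cfg_22 : rd (cfg c x q m P i I J t a) 22 = c.ρ := rfl
lemma cfg_23 : rd (cfg c x q m P i I J t a) 23 = 0 := rfl
lemma cfg_24 : rd (cfg c x q m P i I J t a) 24 = c.D + c.ρ := rfl
end cfg

attribute [simp] cfg_upd7 cfg_upd8 cfg_upd9 cfg_upd10 cfg_upd11 cfg_upd12 cfg_upd13 cfg_upd14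
  cfg_upd15 cfg_0 cfg_1 cfg_2 cfg_3 cfg_4 cfg_5 cfg_6 cfg_7 cfg_8 cfg_9 cfg_10 cfg_11 cfg_12 cfg_13
  cfg_14 cfg_15 cfg_16 cfg_17 cfg_18 cfg_19 cfg_20 cfg_21 cfg_22 cfg_23 cfg_24

/-- Bounds for the numbers that occur in the computation. -/
structure Consts.Bounds (c : Consts) (B E : ℕ) : Prop where
  R_le : c.R ≤ E
  s_le : c.s ≤ E
  E_le : E ≤ B
  κ_le : c.κ ≤ B
  adr_le : c.D + 2 * c.ρ + 9 ≤ B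
  o_lt : c.o < c.D + c.ρ
  le_o : c.D ≤ c.o
  k_le : c.k * (c.D + 1) ≤ B
  ρ_pos : 0 < c.ρ
  k_pos : 0 < c.k
  s_pos : 0 < c.s
  R_eq : c.R = c.ρ ^ c.k

/-- One factor of a Lagrange basis polynomial. -/
def factorProg : Program :=
  instrs [.enum 17 13] (.seq (.cond (.eq 17 18) .skip
    (instrs [.fop .sub 20 16 17, .fop .mul 19 19 20, .fop .sub 20 18 17, .fop .div 19 19 20] .skip))
    (instrs [.op .add 13 13 21] .skip))

/-- One summand of the interpolation. -/
def summandProg : Program :=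
  instrs [.one 19, .enum 18 12, .set 13 0] (.seq (.loop (.lt 13 4) factorProg)
    (instrs [.op .div 14 12 10, .op .mod 14 14 22, .op .add 14 0 14, .fop .mul 20 19 14,
      .fop .add 15 15 20, .op .add 12 12 21] .skip))

/-- The interpolation at one seed. -/
def interpProg : Program :=
  instrs [.op .mod 14 8 5, .enum 16 14, .op .div 8 8 5, .op .add 15 24 11, .fop .sub 15 15 15,
    .set 12 0] (.seq (.loop (.lt 12 4) summandProg) (instrs [.op .add 11 11 21] .skip))

/-- Copying one of the new values to its place. -/
def copyProg : Program :=
  instrs [.op .add 15 24 11, .op .add 14 0 11, .fop .sub 14 14 14, .fop .add 14 14 15,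
    .op .add 11 11 21] .skip

/-- One level of the construction. -/
def levelProg : Program :=
  instrs [.op .div 14 7 9, .op .mod 14 14 3, .set 10 1, .set 11 0]
    (.seq (.loop (.lt 11 14) (instrs [.op .mul 10 10 22, .op .add 11 11 21] .skip))
      (instrs [.set 11 0] (.seq (.loop (.lt 11 22) interpProg)
        (instrs [.set 11 0] (.seq (.loop (.lt 11 22) copyProg)
          (instrs [.op .mul 9 9 3] .skip))))))

/-- One coordinate. -/
def coordProg : Program :=
  instrs [.op .add 8 2 23, .set 11 0]
    (.seq (.loop (.lt 11 22) (instrs [.op .mod 14 8 5, .op .add 15 0 11, .enum 15 14,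
      .op .div 8 8 5, .op .add 11 11 21] .skip))
      (instrs [.set 9 1] (.seq (.loop (.lt 9 0) levelProg)
        (instrs [.fop .sub 7 7 7, .fop .add 7 7 6, .op .add 7 7 21] .skip))))

/-- The program that outputs a point; `ρ` is the number of points of each level. -/
def pointProg (ρ : ℕ) : Program :=
  instrs [.set 21 1, .set 22 ρ, .op .add 24 0 22, .op .add 16 24 22, .op .add 17 16 21,
    .op .add 18 17 21, .op .add 19 18 21, .op .add 20 19 21, .op .mod 6 2 22, .op .add 6 6 0,
    .op .div 2 2 22, .set 3 2, .set 4 (ρ ^ 2), .op .add 14 0 23, .set 15 2]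
    (.seq (.loop (.lt 23 14) (instrs [.op .div 14 14 15, .op .add 3 3 21, .op .mul 4 4 22] .skip))
      (instrs [.op .add 14 0 21, .op .mul 5 4 14, .op .mul 5 5 14, .op .add 14 1 21,
        .op .mul 5 5 14, .set 7 0] (.loop (.lt 7 0) coordProg)))

/-! ### Correctness and running time of the program -/

section
variable {F : Type*} [Field F] {e : ℕ → F} {w B E : ℕ} {c : Consts}

/-- Layout of the field memory: the cells below `D` hold the coordinates, the next `ρ` the values of
the current level, the next `ρ` those of the new level. From `D + 2 * ρ` on follow the interpolation
parameter, `e J`, `e I`, the running product and a scratch cell. -/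
lemma tri_factor (H : Costs B E w) (hB : c.Bounds B E) (x q m P i I t a : ℕ) (g : ℕ → F)
    (hg : g (c.D + 2 * c.ρ + 2) = e I) :
    Tri e w (.loop (.lt 13 4) factorProg) (mem (cfg c x q m P i I 0 t a) g) (c.R * 10 + 1)
      (fun s => ∃ g', s = mem (cfg c x q m P i I c.R t a) g' ∧
        g' (c.D + 2 * c.ρ + 3) = g (c.D + 2 * c.ρ + 3) * lag e c.R I (g (c.D + 2 * c.ρ)) ∧
        ∀ y ≤ c.D + 2 * c.ρ, g' y = g y) := by
  have h1 := hB.R_le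
  have h2 := hB.E_le
  have h3 := hB.adr_le
  refine (Tri.loop (fun J s => ∃ g', s = mem (cfg c x q m P i I J t a) g' ∧
        g' (c.D + 2 * c.ρ + 3) = g (c.D + 2 * c.ρ + 3) * lag e J I (g (c.D + 2 * c.ρ)) ∧
        g' (c.D + 2 * c.ρ + 2) = g (c.D + 2 * c.ρ + 2) ∧
        ∀ y ≤ c.D + 2 * c.ρ, g' y = g y) (τ := 9) ?_ ?_ ?_ ?_).mono le_rfl ?_
  · rintro J hJ _ ⟨g', rfl, -⟩
    exact cost_lt_le H (by simp; omega) (by simp; omega)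
  · rintro J hJ _ ⟨g', rfl, -⟩
    simp [Test.Holds, mem]
  · rintro J hJ _ ⟨g', rfl, ht, hb, hy⟩
    refine (tri_enum H (by simp; omega) (by simp; omega) (tri_instrs_nil (Tri.seq
      (R := fun s => ∃ g', s = mem (cfg c x q m P i I J t a) g' ∧
        g' (c.D + 2 * c.ρ + 3) = g (c.D + 2 * c.ρ + 3) * lag e (J + 1) I (g (c.D + 2 * c.ρ)) ∧
        g' (c.D + 2 * c.ρ + 2) = g (c.D + 2 * c.ρ + 2) ∧
        ∀ y ≤ c.D + 2 * c.ρ, g' y = g y) (τ₁ := 6) (τ₂ := 2) ?_ ?_))).mono le_rfl fun _ h => h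
    · have hw : 1 ≤ w := by have := H.size 0 (Nat.zero_le _); omega
      refine Tri.cond (cost_eq_le H (by simp; omega) (by simp; omega)) (fun h => ?_) (fun h => ?_)
      · have h' : e J = e I := by simpa [Test.Holds, mem, hb, hg] using h
        refine (Tri.skip hw ⟨_, rfl, ?_, ?_, fun y hy' => ?_⟩).mono (by omega) fun _ h => h
        · simp [ht, lag, Finset.prod_range_succ, h']
        · simp [hb]
        · simp [show y ≠ c.D + 2 * c.ρ + 1 by omega, hy y hy']
      · have h' : e J ≠ e I := by simpa [Test.Holds, mem, hb, hg] using h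
        refine tri_fop H (by simp; omega) (by simp; omega) (by simp; omega) ?_
        refine tri_fop H (by simp; omega) (by simp; omega) (by simp; omega) ?_
        refine tri_fop H (by simp; omega) (by simp; omega) (by simp; omega) ?_
        refine tri_fop H (by simp; omega) (by simp; omega) (by simp; omega) ?_
        refine tri_instrs_skip H ⟨_, rfl, ?_, ?_, fun y hy' => ?_⟩
        · simp [ht, lag, Finset.prod_range_succ, h', FieldOp.eval, hb, hg, hy, mul_assoc,
            mul_div_assoc]
        · simp [hb]
        · simp [show y ≠ c.D + 2 * c.ρ + 1 by omega, show y ≠ c.D + 2 * c.ρ + 3 by omega,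
            show y ≠ c.D + 2 * c.ρ + 4 by omega, hy y hy']
    · rintro _ ⟨g'', rfl, h⟩
      refine tri_op H (by simp; omega) (by simp; omega) ?_
      exact tri_instrs_skip H ⟨g'', rfl, h⟩
  · exact ⟨g, rfl, by simp [lag], rfl, fun _ _ => rfl⟩
  · rintro _ ⟨g', rfl, ha, -, hy⟩
    exact ⟨g', rfl, ha, hy⟩
end

section
variable {F : Type*} [Field F] {e : ℕ → F} {w B E : ℕ} {c : Consts}

lemma tri_summands (H : Costs B E w) (hB : c.Bounds B E) (x q m P i J t a : ℕ) (g : ℕ → F)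
    (ha : c.D + c.ρ ≤ a) (ha' : a < c.D + 2 * c.ρ) (hP : P ≤ B) (hg : g a = 0) :
    Tri e w (.loop (.lt 12 4) summandProg) (mem (cfg c x q m P i 0 J t a) g)
      (c.R * (c.R * 10 + 12) + 1)
      (fun s => ∃ g' I J t, s = mem (cfg c x q m P i I J t a) g' ∧
        g' a = ∑ I ∈ Finset.range c.R,
          lag e c.R I (g (c.D + 2 * c.ρ)) * g (c.D + I / P % c.ρ) ∧
        ∀ y < c.D + 2 * c.ρ, y ≠ a → g' y = g y) := by
  have h1 := hB.R_le
  have h2 := hB.E_le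
  have h3 := hB.adr_le
  refine (Tri.loop (fun I s => ∃ g' J t, s = mem (cfg c x q m P i I J t a) g' ∧
        g' a = ∑ I ∈ Finset.range I,
          lag e c.R I (g (c.D + 2 * c.ρ)) * g (c.D + I / P % c.ρ) ∧
        ∀ y ≤ c.D + 2 * c.ρ, y ≠ a → g' y = g y) (τ := c.R * 10 + 11) ?_ ?_ ?_ ?_).mono le_rfl ?_
  · rintro I hI _ ⟨g', J, t, rfl, -⟩
    exact cost_lt_le H (by simp; omega) (by simp; omega)
  · rintro I hI _ ⟨g', J, t, rfl, -⟩
    simp [Test.Holds, mem]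
  · rintro I hI _ ⟨g', J, t, rfl, hs, hy⟩
    refine (tri_one H (by simp; omega) (tri_enum H (by simp; omega) (by simp; omega)
      (tri_set H (Nat.zero_le _) (tri_instrs_nil (Tri.seq
        (tri_factor H hB x q m P i I t a _ (by simp))
        (τ₂ := 7) ?_))))).mono (by omega) fun _ h => h
    rintro _ ⟨g'', rfl, hT, hy'⟩
    have hmod := Nat.mod_lt (I / P) hB.ρ_pos
    have hdiv : I / P ≤ I := Nat.div_le_self _ _
    simp only [cfg_18, cfg_19] at hT hy'
    refine tri_op H (by simp; omega) (by simpa using hP) ?_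
    refine tri_op H (by simp [NatOp.eval]; omega) (by simp; omega) ?_
    refine tri_op H (by simp; omega) (by simp [NatOp.eval]; omega) ?_
    refine tri_fop H (by simp; omega) (by simp; omega) (by simp [NatOp.eval]; omega) ?_
    refine tri_fop H (by simp; omega) (by simp; omega) (by simp; omega) ?_
    refine tri_op H (by simp; omega) (by simp; omega) ?_
    simp only [cfg_upd12, cfg_upd14, cfg_0, cfg_10, cfg_12, cfg_14, cfg_15, cfg_19, cfg_20, cfg_21,
      cfg_22, NatOp.eval, FieldOp.eval]
    have hgy : ∀ y ≤ c.D + 2 * c.ρ, g'' y = g' y := by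
      intro y hyl
      rw [hy' y hyl, Function.update_of_ne (by omega), Function.update_of_ne (by omega)]
    refine tri_instrs_skip H ⟨_, _, _, rfl, ?_, fun y hyl hya => ?_⟩
    · rw [Finset.sum_range_succ, ← hs]
      rw [Function.update_self, Function.update_self, Function.update_of_ne (by omega), hT,
        hgy a (by omega), hgy _ (by omega)]
      simp [hy (c.D + 2 * c.ρ) le_rfl (by omega),
        hy (c.D + I / P % c.ρ) (by omega) (by omega)]
    · rw [Function.update_of_ne hya, Function.update_of_ne (by omega), hgy y hyl, hy y hyl hya]
  · exact ⟨g, J, t, rfl, by simpa using hg, fun _ _ _ => rfl⟩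
  · rintro _ ⟨g', J, t, rfl, hs, hy⟩
    exact ⟨g', _, J, t, rfl, hs, fun y hyl => hy y hyl.le⟩

/-- The digits of `q` in base `s` are the seeds not yet used; each round consumes the lowest one. -/
lemma tri_interp (H : Costs B E w) (hB : c.Bounds B E) (x q m P I J t a : ℕ) (g : ℕ → F)
    (hP : P ≤ B) (hq : q ≤ B) :
    Tri e w (.loop (.lt 11 22) interpProg) (mem (cfg c x q m P 0 I J t a) g)
      (c.ρ * (c.R * (c.R * 10 + 12) + 10) + 1)
      (fun s => ∃ g' I J t a, s = mem (cfg c x (q / c.s ^ c.ρ) m P c.ρ I J t a) g' ∧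
        (∀ i < c.ρ, g' (c.D + c.ρ + i) = ∑ I ∈ Finset.range c.R,
          lag e c.R I (e (q / c.s ^ i % c.s)) * g (c.D + I / P % c.ρ)) ∧
        ∀ y < c.D + c.ρ, g' y = g y) := by
  have h1 := hB.R_le
  have h2 := hB.E_le
  have h3 := hB.adr_le
  have h4 := hB.s_le
  refine Tri.loop (fun i s => ∃ g' I J t a, s = mem (cfg c x (q / c.s ^ i) m P i I J t a) g' ∧
        (∀ i' < i, g' (c.D + c.ρ + i') = ∑ I ∈ Finset.range c.R,
          lag e c.R I (e (q / c.s ^ i' % c.s)) * g (c.D + I / P % c.ρ)) ∧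
        ∀ y < c.D + c.ρ, g' y = g y) (τ := c.R * (c.R * 10 + 12) + 9) ?_ ?_ ?_ ?_
  · rintro i hi _ ⟨g', I, J, t, a, rfl, -⟩
    exact cost_lt_le H (by simp; omega) (by simp; omega)
  · rintro i hi _ ⟨g', I, J, t, a, rfl, -⟩
    simp [Test.Holds, mem]
  · rintro i hi _ ⟨g', I, J, t, a, rfl, hs, hy⟩
    have hqi : q / c.s ^ i ≤ q := Nat.div_le_self _ _
    have hmod := Nat.mod_lt (q / c.s ^ i) hB.s_pos
    refine (tri_op H (by simp; omega) (by simp; omega) (tri_enum H (by simp; omega)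
      (by simp [NatOp.eval]; omega) (tri_op H (by simp; omega) (by simp; omega)
      (tri_op H (by simp; omega) (by simp; omega) (tri_fop H (by simp [NatOp.eval]; omega)
      (by simp [NatOp.eval]; omega) (by simp [NatOp.eval]; omega)
      (tri_set H (Nat.zero_le _) (tri_instrs_nil (Tri.seq
        (tri_summands H hB x _ m P i J _ (c.D + c.ρ + i) _ (by omega) (by omega) hP ?_)
        (τ₂ := 2) ?_)))))))).mono (by omega) fun _ h => h
    · simp [NatOp.eval, FieldOp.eval]
    rintro _ ⟨g'', I', J', t', rfl, hsum, hy''⟩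
    simp only [cfg_upd14, cfg_upd15, cfg_upd8, cfg_8, cfg_5, cfg_11, cfg_14, cfg_15, cfg_16, cfg_24,
      NatOp.eval, FieldOp.eval, sub_self] at hsum hy'' ⊢
    refine tri_op H (by simp; omega) (by simp; omega) (tri_instrs_skip H ?_)
    refine ⟨g'', I', J', t', c.D + c.ρ + i, ?_, fun i' hi' => ?_, fun y hyl => ?_⟩
    · simp [NatOp.eval, Nat.div_div_eq_div_mul, pow_succ]
    · rcases Nat.lt_succ_iff_lt_or_eq.1 hi' with hi' | rfl
      · rw [hy'' _ (by omega) (by omega), Function.update_of_ne (by omega),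
          Function.update_of_ne (by omega), hs _ hi']
      · rw [hsum]
        refine Finset.sum_congr rfl fun I'' _ => ?_
        have := Nat.mod_lt (I'' / P) hB.ρ_pos
        rw [Function.update_of_ne (by omega), Function.update_self,
          Function.update_of_ne (by omega), Function.update_of_ne (by omega), hy _ (by omega)]
    · rw [hy'' _ (by omega) (by omega), Function.update_of_ne (by omega),
          Function.update_of_ne (by omega), hy _ hyl]
  · exact ⟨g, I, J, t, a, by simp, by simp, fun _ _ => rfl⟩

/-- Copying waits until all new values are computed, since each of them may use all old ones. There
is no move instruction for field elements: the target is cleared by subtracting it from itself, and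
then the source is added. -/
lemma tri_copy (H : Costs B E w) (hB : c.Bounds B E) (x q m P I J t a : ℕ) (g : ℕ → F) :
    Tri e w (.loop (.lt 11 22) copyProg) (mem (cfg c x q m P 0 I J t a) g) (c.ρ * 7 + 1)
      (fun s => ∃ g' t a, s = mem (cfg c x q m P c.ρ I J t a) g' ∧
        (∀ i < c.ρ, g' (c.D + i) = g (c.D + c.ρ + i)) ∧ ∀ y < c.D, g' y = g y) := by
  have h3 := hB.adr_le
  refine (Tri.loop (fun i s => ∃ g' t a, s = mem (cfg c x q m P i I J t a) g' ∧
        (∀ i' < i, g' (c.D + i') = g (c.D + c.ρ + i')) ∧ (∀ y < c.D, g' y = g y) ∧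
        ∀ y, c.D + c.ρ ≤ y → g' y = g y) (τ := 6) ?_ ?_ ?_ ?_).mono le_rfl ?_
  · rintro i hi _ ⟨g', t, a, rfl, -⟩
    exact cost_lt_le H (by simp; omega) (by simp; omega)
  · rintro i hi _ ⟨g', t, a, rfl, -⟩
    simp [Test.Holds, mem]
  · rintro i hi _ ⟨g', t, a, rfl, hs, hy, hy'⟩
    refine tri_op H (by simp; omega) (by simp; omega) ?_
    refine tri_op H (by simp; omega) (by simp; omega) ?_
    refine tri_fop H (by simp [NatOp.eval]; omega) (by simp [NatOp.eval]; omega)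
      (by simp [NatOp.eval]; omega) ?_
    refine tri_fop H (by simp [NatOp.eval]; omega) (by simp [NatOp.eval]; omega)
      (by simp [NatOp.eval]; omega) ?_
    refine tri_op H (by simp; omega) (by simp; omega) ?_
    simp only [cfg_upd11, cfg_upd14, cfg_upd15, cfg_0, cfg_11, cfg_14, cfg_15, cfg_21, cfg_24,
      NatOp.eval, FieldOp.eval, sub_self]
    refine tri_instrs_skip H ⟨_, _, _, rfl, fun i' hi' => ?_, fun y hyl => ?_, fun y hyl => ?_⟩
    · rcases Nat.lt_succ_iff_lt_or_eq.1 hi' with hi' | rfl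
      · rw [Function.update_of_ne (by omega), Function.update_of_ne (by omega), hs _ hi']
      · rw [Function.update_self, Function.update_self, Function.update_of_ne (by omega),
          hy' _ (by omega), zero_add]
    · rw [Function.update_of_ne (by omega), Function.update_of_ne (by omega), hy _ hyl]
    · rw [Function.update_of_ne (by omega), Function.update_of_ne (by omega), hy' _ hyl]
  · exact ⟨g, t, a, rfl, by simp, fun _ _ => rfl, fun _ _ => rfl⟩
  · rintro _ ⟨g', t, a, rfl, hs, hy, -⟩
    exact ⟨g', t, a, rfl, hs, hy⟩

lemma tri_power (H : Costs B E w) (hB : c.Bounds B E) (x q m I J j a : ℕ) (g : ℕ → F)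
    (hj : j < c.k) :
    Tri e w (.loop (.lt 11 14) (instrs [.op .mul 10 10 22, .op .add 11 11 21] .skip))
      (mem (cfg c x q m 1 0 I J j a) g) (c.k * 4 + 1)
      (fun s => s = mem (cfg c x q m (c.ρ ^ j) j I J j a) g) := by
  have h1 := hB.R_le
  have h2 := hB.E_le
  have h3 := hB.adr_le
  have h4 := hB.k_le
  have h5 : c.k ≤ c.k * (c.D + 1) := Nat.le_mul_of_pos_right _ (by omega)
  refine (Tri.loop (fun i s => s = mem (cfg c x q m (c.ρ ^ i) i I J j a) g) (m := j)
    (τ := 3) ?_ ?_ ?_ (by simp)).mono (by omega) fun _ h => h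
  · rintro i hi _ rfl
    exact cost_lt_le H (by simp; omega) (by simp; omega)
  · rintro i hi _ rfl
    simp [Test.Holds, mem]
  · rintro i hi _ rfl
    have hP : c.ρ ^ i ≤ c.R := hB.R_eq ▸ Nat.pow_le_pow_right hB.ρ_pos (by omega)
    refine tri_op H (by simp; omega) (by simp; omega) ?_
    refine tri_op H (by simp; omega) (by simp; omega) ?_
    exact tri_instrs_skip H (by simp [NatOp.eval, pow_succ])

/-- A bound for the number of steps of one level. -/
def levelSteps (c : Consts) : ℕ :=
  c.k * 4 + c.ρ * (c.R * (c.R * 10 + 12) + 10) + c.ρ * 7 + 11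

/-- One step of the recursion of `gen` at a fixed `x`; `hσ` says that the lowest digits of `q` are
the seeds of level `l + 1`. -/
lemma tri_level (H : Costs B E w) (hB : c.Bounds B E) (σ : ℕ → ℕ) (l x q P i I J t a : ℕ)
    (g : ℕ → F) (hl : c.k ^ l < c.D) (hx : x < c.D) (hq : q ≤ B)
    (hσ : ∀ i < c.ρ, q / c.s ^ i % c.s = σ ((l + 1) * c.ρ + i))
    (hg : ∀ i < c.ρ, g (c.D + i) = gen e σ c.ρ c.k c.R l i x) :
    Tri e w levelProg (mem (cfg c x q (c.k ^ l) P i I J t a) g) (levelSteps c)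
      (fun s => ∃ g' P i I J t a,
        s = mem (cfg c x (q / c.s ^ c.ρ) (c.k ^ (l + 1)) P i I J t a) g' ∧
        (∀ i < c.ρ, g' (c.D + i) = gen e σ c.ρ c.k c.R (l + 1) i x) ∧
        ∀ y < c.D, g' y = g y) := by
  have h1 := hB.R_le
  have h2 := hB.E_le
  have h3 := hB.adr_le
  have h4 := hB.k_le
  have h5 : c.k ≤ c.k * (c.D + 1) := Nat.le_mul_of_pos_right _ (by omega)
  have h6 : x / c.k ^ l ≤ x := Nat.div_le_self _ _
  set j := x / c.k ^ l % c.k with hj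
  have hjk : j < c.k := Nat.mod_lt _ hB.k_pos
  have hP : c.ρ ^ j ≤ c.R := hB.R_eq ▸ Nat.pow_le_pow_right hB.ρ_pos hjk.le
  refine (tri_op H (by simp; omega) (by simp; omega) (tri_op H (by simp [NatOp.eval]; omega)
    (by simp; omega) (tri_set H (by omega) (tri_set H (Nat.zero_le _) (tri_instrs_nil (Tri.seq
      (tri_power H hB x q (c.k ^ l) I J j a g hjk)
      (τ₂ := c.ρ * (c.R * (c.R * 10 + 12) + 10) + 1 + 1 + (c.ρ * 7 + 1 + 1 + 2)) ?_)))))).mono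
        (by unfold levelSteps; omega) fun _ h => h
  rintro _ rfl
  refine (tri_set H (Nat.zero_le _) (tri_instrs_nil (Tri.seq
    (tri_interp H hB x q (c.k ^ l) (c.ρ ^ j) I J j a g (by omega) hq)
    (τ₂ := c.ρ * 7 + 1 + 1 + 2) ?_))).mono (by omega) fun _ h => h
  rintro _ ⟨g₁, I, J, t, a, rfl, hs, hy⟩
  refine (tri_set H (Nat.zero_le _) (tri_instrs_nil (Tri.seq
    (tri_copy H hB x _ (c.k ^ l) (c.ρ ^ j) I J t a g₁)
    (τ₂ := 2) ?_))).mono (by omega) fun _ h => h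
  rintro _ ⟨g₂, t, a, rfl, hs', hy'⟩
  refine tri_op H (by simp; omega) (by simp; omega) (tri_instrs_skip H ?_)
  refine ⟨g₂, c.ρ ^ j, c.ρ, I, J, t, a, by simp [NatOp.eval, pow_succ], fun i hi => ?_, fun y hyl => ?_⟩
  · rw [hs' i hi, hs i hi, gen]
    refine Finset.sum_congr rfl fun I _ => ?_
    rw [hσ i hi, hg _ (Nat.mod_lt _ hB.ρ_pos)]
  · rw [hy' y hyl, hy y (by omega)]
end

section
variable {F : Type*} [Field F] {e : ℕ → F} {w B E : ℕ} {c : Consts}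

lemma tri_seeds (H : Costs B E w) (hB : c.Bounds B E) (x m P I J t a : ℕ) (g : ℕ → F) :
    Tri e w (.loop (.lt 11 22) (instrs [.op .mod 14 8 5, .op .add 15 0 11, .enum 15 14,
        .op .div 8 8 5, .op .add 11 11 21] .skip))
      (mem (cfg c x c.κ m P 0 I J t a) g) (c.ρ * 7 + 1)
      (fun s => ∃ g' t a, s = mem (cfg c x (c.κ / c.s ^ c.ρ) m P c.ρ I J t a) g' ∧
        (∀ i < c.ρ, g' (c.D + i) = e (c.κ / c.s ^ i % c.s)) ∧ ∀ y < c.D, g' y = g y) := by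
  have h2 := hB.E_le
  have h3 := hB.adr_le
  have h4 := hB.s_le
  have h5 := hB.κ_le
  refine Tri.loop (fun i s => ∃ g' t a, s = mem (cfg c x (c.κ / c.s ^ i) m P i I J t a) g' ∧
        (∀ i' < i, g' (c.D + i') = e (c.κ / c.s ^ i' % c.s)) ∧ ∀ y < c.D, g' y = g y)
    (τ := 6) ?_ ?_ ?_ ?_
  · rintro i hi _ ⟨g', t, a, rfl, -⟩
    exact cost_lt_le H (by simp; omega) (by simp; omega)
  · rintro i hi _ ⟨g', t, a, rfl, -⟩
    simp [Test.Holds, mem]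
  · rintro i hi _ ⟨g', t, a, rfl, hs, hy⟩
    have hqi : c.κ / c.s ^ i ≤ c.κ := Nat.div_le_self _ _
    have hmod := Nat.mod_lt (c.κ / c.s ^ i) hB.s_pos
    refine tri_op H (by simp; omega) (by simp; omega) ?_
    refine tri_op H (by simp; omega) (by simp; omega) ?_
    refine tri_enum H (by simp [NatOp.eval]; omega) (by simp [NatOp.eval]; omega) ?_
    refine tri_op H (by simp; omega) (by simp; omega) ?_
    refine tri_op H (by simp; omega) (by simp; omega) ?_
    refine tri_instrs_skip H ⟨_, _, _, by simp [NatOp.eval, pow_succ, Nat.div_div_eq_div_mul]; rfl,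
      fun i' hi' => ?_, fun y hyl => ?_⟩
    · rcases Nat.lt_succ_iff_lt_or_eq.1 hi' with hi' | rfl
      · rw [Function.update_of_ne (by omega), hs _ hi']
      · rw [Function.update_self]
    · rw [Function.update_of_ne (by omega), hy _ hyl]
  · exact ⟨g, t, a, by simp, by simp, fun _ _ => rfl⟩

/-- The seeds that are encoded in an index. -/
def seeds (κ s t : ℕ) : ℕ := κ / s ^ t % s

/-- The seeds are read from `κ` afresh for each coordinate. The level loop needs no counter: its
test `k ^ l < D` holds exactly for `l < clog k D`. -/
lemma tri_coords (H : Costs B E w) (hB : c.Bounds B E) (hk : 1 < c.k) (q m P i I J t a : ℕ)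
    (g : ℕ → F) :
    Tri e w (.loop (.lt 7 0) coordProg) (mem (cfg c 0 q m P i I J t a) g)
      (c.D * (c.ρ * 7 + Nat.clog c.k c.D * (levelSteps c + 1) + 11) + 1)
      (fun s => ∀ x < c.D, s.fld x =
        gen e (seeds c.κ c.s) c.ρ c.k c.R (Nat.clog c.k c.D) (c.o - c.D) x) := by
  have h2 := hB.E_le
  have h3 := hB.adr_le
  have h4 := hB.s_le
  have h5 := hB.κ_le
  have h6 := hB.k_le
  have h7 := hB.le_o
  have h8 := hB.o_lt
  refine (Tri.loop (fun x s => ∃ g' q m P i I J t a, s = mem (cfg c x q m P i I J t a) g' ∧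
      ∀ y < x, g' y = gen e (seeds c.κ c.s) c.ρ c.k c.R (Nat.clog c.k c.D) (c.o - c.D) y)
    (τ := c.ρ * 7 + Nat.clog c.k c.D * (levelSteps c + 1) + 10) ?_ ?_ ?_ ?_).mono le_rfl ?_
  · rintro x hx _ ⟨g', q, m, P, i, I, J, t, a, rfl, -⟩
    exact cost_lt_le H (by simp; omega) (by simp; omega)
  · rintro x hx _ ⟨g', q, m, P, i, I, J, t, a, rfl, -⟩
    simp [Test.Holds, mem]
  · rintro x hx _ ⟨g', q, m, P, i, I, J, t, a, rfl, hs⟩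
    refine (tri_op H (by simp; omega) (by simp) (tri_set H (Nat.zero_le _)
      (tri_instrs_nil (Tri.seq (tri_seeds H hB x m P I J t a g')
        (τ₂ := Nat.clog c.k c.D * (levelSteps c + 1) + 1 + 4 + 1) ?_)))).mono
        (by omega) fun _ h => h
    rintro _ ⟨g₁, t, a, rfl, hs₁, hy₁⟩
    refine tri_set H (by omega) (tri_instrs_nil (Tri.seq (τ₂ := 4)
      (R := fun s => ∃ g' q m P i I J t a, s = mem (cfg c x q m P i I J t a) g' ∧
        (∀ i < c.ρ, g' (c.D + i) =
          gen e (seeds c.κ c.s) c.ρ c.k c.R (Nat.clog c.k c.D) i x) ∧ ∀ y < c.D, g' y = g₁ y)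
      ?_ ?_))
    · refine (Tri.loop (fun l s => ∃ g' P i I J t a,
        s = mem (cfg c x (c.κ / c.s ^ ((l + 1) * c.ρ)) (c.k ^ l) P i I J t a) g' ∧
        (∀ i < c.ρ, g' (c.D + i) = gen e (seeds c.κ c.s) c.ρ c.k c.R l i x) ∧
        ∀ y < c.D, g' y = g₁ y) (m := Nat.clog c.k c.D) (τ := levelSteps c) ?_ ?_ ?_ ?_).mono
          le_rfl ?_
      · rintro l hl _ ⟨g', P, i, I, J, t, a, rfl, -⟩
        refine cost_lt_le H ?_ (by simp; omega)
        simp only [cfg_9]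
        refine le_trans ?_ h6
        rcases l with _ | l
        · exact Nat.mul_pos hB.k_pos (Nat.succ_pos _)
        -- The final power may exceed `D`, but by less than a factor `k`.
        · have := (Nat.lt_clog_iff_pow_lt hk).1 (Nat.lt_of_succ_le hl)
          rw [pow_succ, mul_comm]
          exact Nat.mul_le_mul_left _ (by omega)
      · rintro l hl _ ⟨g', P, i, I, J, t, a, rfl, -⟩
        simp only [Test.Holds, mem, cfg_9, cfg_0]
        exact (Nat.lt_clog_iff_pow_lt hk).symm
      · rintro l hl _ ⟨g', P, i, I, J, t, a, rfl, hs', hy'⟩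
        have hql : c.κ / c.s ^ ((l + 1) * c.ρ) ≤ c.κ := Nat.div_le_self _ _
        refine (tri_level H hB (seeds c.κ c.s) l x _ P i I J t a g'
          ((Nat.lt_clog_iff_pow_lt hk).1 hl) hx (by omega) (fun i _ => ?_) hs').mono le_rfl ?_
        · rw [seeds, Nat.div_div_eq_div_mul, ← pow_add]
        · rintro _ ⟨g'', P, i, I, J, t, a, rfl, hs'', hy''⟩
          refine ⟨g'', P, i, I, J, t, a, ?_, hs'', fun y hy => by rw [hy'' y hy, hy' y hy]⟩
          rw [Nat.div_div_eq_div_mul, ← pow_add, add_mul (l + 1), one_mul]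
      · exact ⟨g₁, P, c.ρ, I, J, t, a, by simp, hs₁, fun _ _ => rfl⟩
      · rintro _ ⟨g', P, i, I, J, t, a, rfl, h⟩
        exact ⟨g', _, _, P, i, I, J, t, a, rfl, h⟩
    · rintro _ ⟨g₂, q, m, P, i, I, J, t, a, rfl, hs₂, hy₂⟩
      refine tri_fop H (by simp; omega) (by simp; omega) (by simp; omega) ?_
      refine tri_fop H (by simp; omega) (by simp; omega) (by simp; omega) ?_
      refine tri_op H (by simp; omega) (by simp; omega) ?_
      refine tri_instrs_skip H ⟨_, q, m, P, i, I, J, t, a, by simp [NatOp.eval]; rfl,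
        fun y hyx => ?_⟩
      rcases Nat.lt_succ_iff_lt_or_eq.1 hyx with hy | rfl
      · rw [Function.update_of_ne (by omega), hy₂ y (by omega),
          hy₁ y (by omega), hs y hy]
      · rw [Function.update_self, Function.update_of_ne (by omega)]
        have := hs₂ (c.o - c.D) (by omega)
        rw [show c.D + (c.o - c.D) = c.o by omega] at this
        simp [FieldOp.eval, this]
  · exact ⟨g, q, m, P, i, I, J, t, a, rfl, by simp⟩
  · rintro _ ⟨g', q, m, P, i, I, J, t, a, rfl, h⟩
    exact h

/-- The constants for an input. -/
def consts (ρ D n κ : ℕ) : Consts where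
  D := D
  n := n
  κ := κ / ρ
  k := Nat.size D + 2
  R := ρ ^ (Nat.size D + 2)
  s := ρ ^ (Nat.size D + 2) * (D + 1) * (D + 1) * (n + 1)
  o := κ % ρ + D
  ρ := ρ

lemma tri_pointProg (H : Costs B E w) (ρ D n κ : ℕ) (hB : (consts ρ D n κ).Bounds B E)
    (hn : n + 1 ≤ B) (hκ : κ ≤ B) (hρ : ρ ^ 2 ≤ B) :
    Tri e w (pointProg ρ) (Memory.init F [D, n, κ])
      (D.size * 5 + 24 + (D * (ρ * 7 + Nat.clog (D.size + 2) D *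
        (levelSteps (consts ρ D n κ) + 1) + 11) + 1))
      (fun s => ∀ x < D, s.fld x = gen e (seeds (κ / ρ) (consts ρ D n κ).s) ρ (D.size + 2)
        (ρ ^ (D.size + 2)) (Nat.clog (D.size + 2) D) (κ % ρ) x) := by
  have h1 := hB.R_le
  have h2 := hB.E_le
  have h3 := hB.adr_le
  have h4 := hB.s_le
  have h6 := hB.k_le
  simp only [consts] at h1 h3 h4 h6
  have hk5 : D.size + 2 ≤ (D.size + 2) * (D + 1) := Nat.le_mul_of_pos_right _ (by omega)
  have hρ0 : 0 < ρ := hB.ρ_pos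
  have hmod := Nat.mod_lt κ hρ0
  have hz : ∀ v, v ≤ 9 → v ≤ B := fun v hv => by omega
  have hRk : ∀ j ≤ D.size, ρ ^ (j + 2) ≤ B := fun j hj =>
    (Nat.pow_le_pow_right hρ0 (by omega)).trans (h1.trans h2)
  change Tri e w (pointProg ρ) (mem [D, n, κ] fun _ => 0) _ _
  unfold pointProg
  refine Tri.mono (τ := D.size * 5 + 1 + (D * (ρ * 7 + Nat.clog (D.size + 2) D *
        (levelSteps (consts ρ D n κ) + 1) + 11) + 1 + 6) + 15) ?_ (by omega) fun _ h => h
  refine tri_set H (hz _ (by omega)) (tri_set H (show ρ ≤ B by omega) ?_)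
  refine tri_op H (show D ≤ B by omega) (show ρ ≤ B by omega) ?_
  refine tri_op H (show D + ρ ≤ B by omega) (show ρ ≤ B by omega) ?_
  refine tri_op H (show D + ρ + ρ ≤ B by omega) (show 1 ≤ B by omega) ?_
  refine tri_op H (show D + ρ + ρ + 1 ≤ B by omega) (show 1 ≤ B by omega) ?_
  refine tri_op H (show D + ρ + ρ + 1 + 1 ≤ B by omega) (show 1 ≤ B by omega) ?_
  refine tri_op H (show D + ρ + ρ + 1 + 1 + 1 ≤ B by omega) (show 1 ≤ B by omega) ?_
  refine tri_op H (show κ ≤ B from hκ) (show ρ ≤ B by omega) ?_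
  refine tri_op H (show κ % ρ ≤ B by omega) (show D ≤ B by omega) ?_
  refine tri_op H (show κ ≤ B from hκ) (show ρ ≤ B by omega) ?_
  refine tri_set H (hz _ (by omega)) (tri_set H hρ ?_)
  refine tri_op H (show D ≤ B by omega) (show 0 ≤ B by omega) ?_
  refine tri_set H (hz _ (by omega)) (tri_instrs_nil ?_)
  set st : ℕ → ℕ → ℕ → Consts := fun k R s => ⟨D, n, κ / ρ, k, R, s, κ % ρ + D, ρ⟩ with hst
  -- The state after the first fifteen instructions. The loop that follows halves `D` until it is
  -- `0`, hence runs `D.size` times, and raises `k` and `R` from `2` and `ρ ^ 2`.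
  have hstart : [D, n, κ / ρ, 2, ρ ^ 2, 0, κ % ρ + D, 0, 0, 0, 0, 0, 0, 0, D + 0, 2, D + ρ + ρ,
      D + ρ + ρ + 1, D + ρ + ρ + 1 + 1, D + ρ + ρ + 1 + 1 + 1, D + ρ + ρ + 1 + 1 + 1 + 1, 1, ρ, 0,
      D + ρ] = cfg (st 2 (ρ ^ 2) 0) 0 0 0 0 0 0 0 (D / 2 ^ 0) 2 := by
    simp [hst, cfg, two_mul, ← add_assoc]
  change Tri e w _ (mem [D, n, κ / ρ, 2, ρ ^ 2, 0, κ % ρ + D, 0, 0, 0, 0, 0, 0, 0, D + 0, 2,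
    D + ρ + ρ, D + ρ + ρ + 1, D + ρ + ρ + 1 + 1, D + ρ + ρ + 1 + 1 + 1, D + ρ + ρ + 1 + 1 + 1 + 1,
    1, ρ, 0, D + ρ] _) _ _
  rw [hstart]
  refine Tri.seq (Tri.loop (fun j s => s =
    mem (cfg (st (j + 2) (ρ ^ (j + 2)) 0) 0 0 0 0 0 0 0 (D / 2 ^ j) 2) fun _ => 0)
    (τ := 4) ?_ ?_ ?_ rfl) ?_
  · rintro j hj _ rfl
    have : D / 2 ^ j ≤ D := Nat.div_le_self _ _
    exact cost_lt_le H (by simp) (by simp; omega)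
  · rintro j hj _ rfl
    simp only [Test.Holds, mem, cfg_23, cfg_14]
    rw [Nat.lt_size, Nat.div_pos_iff]
    simp
  · rintro j hj _ rfl
    have : D / 2 ^ j ≤ D := Nat.div_le_self _ _
    have hR := hRk j hj.le
    refine tri_op H (show D / 2 ^ j ≤ B by omega) (show 2 ≤ B by omega) ?_
    refine tri_op H (show j + 2 ≤ B by omega) (show 1 ≤ B by omega) ?_
    refine tri_op H hR (show ρ ≤ B by omega) ?_
    refine tri_instrs_skip H ?_
    rw [pow_succ 2, ← Nat.div_div_eq_div_mul, pow_succ ρ (j + 1 + 1)]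
    rfl
  · rintro _ rfl
    set R := ρ ^ (D.size + 2) with hR
    have hs1 : R * (D + 1) ≤ R * (D + 1) * (D + 1) * (n + 1) := by
      rw [mul_assoc (R * (D + 1))]
      exact Nat.le_mul_of_pos_right _ (by positivity)
    have hs2 : R * (D + 1) * (D + 1) ≤ R * (D + 1) * (D + 1) * (n + 1) :=
      Nat.le_mul_of_pos_right _ (by positivity)
    refine tri_op H (show D ≤ B by omega) (show 1 ≤ B by omega) ?_
    refine tri_op H (show R ≤ B by omega) (show D + 1 ≤ B by omega) ?_
    refine tri_op H (show R * (D + 1) ≤ B by omega) (show D + 1 ≤ B by omega) ?_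
    refine tri_op H (show n ≤ B by omega) (show 1 ≤ B by omega) ?_
    refine tri_op H (show R * (D + 1) * (D + 1) ≤ B by omega) (show n + 1 ≤ B by omega) ?_
    refine tri_set H (Nat.zero_le _) (tri_instrs_nil ?_)
    refine (tri_coords (c := consts ρ D n κ) H hB (by simp [consts]) 0 0 0 0 0 0 (n + 1) 2
      (fun _ => 0)).mono le_rfl fun s h x hx => ?_
    rw [h x hx]
    simp [consts, hR]
end

/-! ## Estimates -/

lemma one_le_lgDivLglg (D : ℕ) : 1 ≤ lgDivLglg D := by
  unfold lgDivLglg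
  split_ifs with h
  · exact le_rfl
  · have hD : (2 : ℝ) < D := by exact_mod_cast not_le.1 h
    set y := Real.logb 2 D with hy
    have hy1 : 1 < y := by
      rw [hy, Real.lt_logb_iff_rpow_lt one_lt_two (by linarith)]
      simpa using hD
    have hly : 0 < Real.logb 2 y := Real.logb_pos one_lt_two hy1
    rw [le_div_iff₀ hly, one_mul, Real.logb, div_le_iff₀ (Real.log_pos one_lt_two)]
    -- The tangent bound is applied to `y / 2`; applied to `y` it would give `y - 1`, which exceeds
    -- `y * log 2` for large `y`.
    have h1 : Real.log y = Real.log (y / 2) + Real.log 2 := by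
      rw [← Real.log_mul (by positivity) (by norm_num)]
      congr 1
      ring
    have h2 := Real.log_le_sub_one_of_pos (show 0 < y / 2 by positivity)
    have h3 := Real.log_two_gt_d9
    have h4 := Real.log_two_lt_d9
    nlinarith

/-- Write the left side as `L + 1`. Then `k ^ L < D` gives `L * lg k ≤ lg D`, and `lg k ≥ lg lg D`
because `k = D.size + 2 ≥ lg D`. -/
lemma clog_le_lgDivLglg (D : ℕ) : (Nat.clog (D.size + 2) D : ℝ) ≤ lgDivLglg D + 1 := by
  have h0 := one_le_lgDivLglg D
  by_cases h : D ≤ 2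
  · have : Nat.clog (D.size + 2) D ≤ 1 := Nat.clog_le_of_le_pow (by rw [pow_one]; omega)
    have : (Nat.clog (D.size + 2) D : ℝ) ≤ 1 := by exact_mod_cast this
    linarith
  · have hD : (2 : ℝ) < D := by exact_mod_cast not_le.1 h
    set k := D.size + 2 with hk
    have hpow := Nat.pow_pred_clog_lt_self (b := k) (by omega) (x := D) (by omega)
    obtain ⟨L, hL⟩ : ∃ L, Nat.clog k D = L + 1 :=
      Nat.exists_eq_succ_of_ne_zero (Nat.clog_pos (by omega) (by omega)).ne'
    rw [hL] at hpow ⊢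
    simp only [Nat.pred_eq_sub_one, Nat.add_sub_cancel] at hpow
    rw [lgDivLglg, if_neg h]
    set y := Real.logb 2 D with hy
    have hy1 : 1 < y := by
      rw [hy, Real.lt_logb_iff_rpow_lt one_lt_two (by linarith)]
      simpa using hD
    have hly : 0 < Real.logb 2 y := Real.logb_pos one_lt_two hy1
    have hyk : y ≤ k := by
      rw [hy, Real.logb_le_iff_le_rpow one_lt_two (by linarith), Real.rpow_natCast]
      have h1 : D ≤ 2 ^ k := (Nat.lt_size_self D).le.trans (Nat.pow_le_pow_right (by omega) (by omega))
      exact_mod_cast h1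
    push_cast
    rw [add_le_add_iff_right, le_div_iff₀ hly]
    have h1 : Real.logb 2 y ≤ Real.logb 2 k :=
      Real.logb_le_logb_of_le one_lt_two (by linarith) hyk
    have h2 : (L : ℝ) * Real.logb 2 k ≤ y := by
      rw [← Real.logb_pow, hy]
      refine Real.logb_le_logb_of_le one_lt_two ?_ ?_
      · have : (0 : ℝ) < k := by linarith
        positivity
      · exact_mod_cast hpow.le
    exact (mul_le_mul_of_nonneg_left h1 (Nat.cast_nonneg L)).trans h2

/-- Since the base is at least `2`, constant factors are absorbed into the exponent. -/
lemma le_pow_add {X u i : ℕ} (hX : 2 ≤ X) (j : ℕ) (h : u ≤ 2 ^ j * X ^ i) : u ≤ X ^ (i + j) := by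
  rw [pow_add, mul_comm]
  exact h.trans (Nat.mul_le_mul_right _ (Nat.pow_le_pow_left hX j))

lemma size_le_self (D : ℕ) : D.size ≤ D := Nat.size_le.2 Nat.lt_two_pow_self

lemma two_pow_size_le (D : ℕ) : 2 ^ D.size ≤ 2 * D + 1 := by
  rcases Nat.eq_zero_or_pos D with rfl | hD
  · simp
  · have h : 2 ^ (D.size - 1) ≤ D :=
      Nat.lt_size.1 (by have := Nat.size_pos.2 hD; omega)
    have h2 : 2 ^ D.size = 2 * 2 ^ (D.size - 1) := by
      rw [← pow_succ', Nat.sub_add_cancel (Nat.size_pos.2 hD)]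
    omega

/-- Exchanging the exponents gives `(2 ^ k) ^ a`, and `2 ^ k` is linear in `D` because `k` is
logarithmic. -/
lemma nodes_le (a D n : ℕ) : (2 ^ a) ^ (D.size + 2) ≤ (D + n + 2) ^ (4 * a) := by
  rw [← pow_mul, mul_comm a, pow_mul, pow_mul]
  refine Nat.pow_le_pow_left ?_ a
  have h := two_pow_size_le D
  refine le_pow_add (i := 1) (by omega) 3 ?_
  rw [pow_add 2 D.size 2, pow_one]
  omega

lemma modulus_le (a D n κ : ℕ) :
    (consts (2 ^ a) D n κ).s ≤ (D + n + 2) ^ (4 * a + 3) := by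
  simp only [consts]
  rw [show (D + n + 2) ^ (4 * a + 3) =
    (D + n + 2) ^ (4 * a) * (D + n + 2) * (D + n + 2) * (D + n + 2) by ring]
  exact Nat.mul_le_mul (Nat.mul_le_mul (Nat.mul_le_mul (nodes_le a D n) (by omega))
    (by omega)) (by omega)

lemma degree_lt_modulus {R : ℕ} (hR : 0 < R) (D n : ℕ) :
    D * (D * (n * R)) < R * ((D + 1) * ((D + 1) * (n + 1))) := by
  calc D * (D * (n * R)) = R * (D * (D * n)) := by ring
    _ < R * ((D + 1) * ((D + 1) * (n + 1))) := by
      refine (Nat.mul_lt_mul_left hR).2 ?_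
      nlinarith [Nat.zero_le (D * n), Nat.zero_le (D * D)]

lemma le_modulus (R D n : ℕ) : R ≤ R * ((D + 1) * ((D + 1) * (n + 1))) :=
  Nat.le_mul_of_pos_right _ (by positivity)

lemma mul_lt_modulus {R : ℕ} (hR : 0 < R) (D n : ℕ) :
    D * n < R * ((D + 1) * ((D + 1) * (n + 1))) := by
  refine lt_of_lt_of_le ?_ (Nat.le_mul_of_pos_left _ hR)
  nlinarith [Nat.zero_le (D * n), Nat.zero_le (D * D), Nat.zero_le (D * D * n)]

lemma clog_le_self (D : ℕ) : Nat.clog (D.size + 2) D ≤ D :=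
  Nat.clog_le_of_le_pow (Nat.lt_two_pow_self.le.trans (Nat.pow_le_pow_left (by omega) D))

/-- A bound for the number of steps of the program. -/
lemma steps_le (a D n κ : ℕ) :
    D.size * 5 + 24 + (D * (2 ^ a * 7 + Nat.clog (D.size + 2) D *
        (levelSteps (consts (2 ^ a) D n κ) + 1) + 11) + 1) ≤ (D + n + 2) ^ (9 * a + 26) := by
  set X := D + n + 2 with hX
  have hX2 : 2 ≤ X := by omega
  have hone : ∀ i, 1 ≤ X ^ i := fun i => Nat.one_le_pow _ _ (by omega)
  have hmono : ∀ {i j}, i ≤ j → X ^ i ≤ X ^ j := fun h => Nat.pow_le_pow_right (by omega) h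
  have hR := nodes_le a D n
  rw [← hX] at hR
  have hL := clog_le_self D
  have hsz := size_le_self D
  have hρ : 2 ^ a ≤ X ^ a := Nat.pow_le_pow_left hX2 a
  set R := (2 ^ a) ^ (D.size + 2) with hRdef
  set L := Nat.clog (D.size + 2) D with hLdef
  have e1 : R * 10 + 12 ≤ X ^ (4 * a + 5) := by
    refine le_pow_add hX2 5 ?_
    have := hone (4 * a)
    omega
  have e2 : R * (R * 10 + 12) ≤ X ^ (8 * a + 5) := by
    rw [show 8 * a + 5 = 4 * a + (4 * a + 5) by ring, pow_add]
    exact Nat.mul_le_mul hR e1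
  have e3 : R * (R * 10 + 12) + 10 ≤ X ^ (8 * a + 5 + 4) := by
    refine le_pow_add hX2 4 ?_
    have := hone (8 * a + 5)
    omega
  have e4 : 2 ^ a * (R * (R * 10 + 12) + 10) ≤ X ^ (9 * a + 9) := by
    rw [show 9 * a + 9 = a + (8 * a + 5 + 4) by ring, pow_add]
    exact Nat.mul_le_mul hρ e3
  have e5 : levelSteps (consts (2 ^ a) D n κ) + 1 ≤ X ^ (9 * a + 9 + 5) := by
    refine le_pow_add hX2 5 ?_
    have h1 := hone (9 * a + 9)
    have h2 := hmono (show a ≤ 9 * a + 9 by omega)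
    have h3 := hmono (show 1 ≤ 9 * a + 9 by omega)
    rw [pow_one] at h3
    have h4 : levelSteps (consts (2 ^ a) D n κ) = (D.size + 2) * 4 +
      2 ^ a * (R * (R * 10 + 12) + 10) + 2 ^ a * 7 + 11 := rfl
    omega
  have e6 : L * (levelSteps (consts (2 ^ a) D n κ) + 1) ≤ X ^ (9 * a + 15) := by
    rw [show 9 * a + 15 = 1 + (9 * a + 9 + 5) by ring, pow_add, pow_one]
    exact Nat.mul_le_mul (by omega) e5
  have e7 : 2 ^ a * 7 + L * (levelSteps (consts (2 ^ a) D n κ) + 1) + 11 ≤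
      X ^ (9 * a + 15 + 5) := by
    refine le_pow_add hX2 5 ?_
    have h1 := hone (9 * a + 15)
    have h2 := hmono (show a ≤ 9 * a + 15 by omega)
    omega
  have e8 : D * (2 ^ a * 7 + L * (levelSteps (consts (2 ^ a) D n κ) + 1) + 11) ≤
      X ^ (9 * a + 21) := by
    rw [show 9 * a + 21 = 1 + (9 * a + 15 + 5) by ring, pow_add, pow_one]
    exact Nat.mul_le_mul (by omega) e7
  refine le_pow_add (i := 9 * a + 21) hX2 5 ?_
  have h1 := hone (9 * a + 21)
  have h2 := hmono (show 1 ≤ 9 * a + 21 by omega)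
  rw [pow_one] at h2
  omega

/-- The number of points. -/
def numPoints (a D n : ℕ) : ℕ :=
  2 ^ a * (consts (2 ^ a) D n 0).s ^ ((Nat.clog (D.size + 2) D + 1) * 2 ^ a)

lemma numPoints_le (a D n : ℕ) : numPoints a D n ≤
    (D + n + 2) ^ (a + (4 * a + 3) * ((Nat.clog (D.size + 2) D + 1) * 2 ^ a)) := by
  rw [numPoints, pow_add, pow_mul _ (4 * a + 3)]
  exact Nat.mul_le_mul (Nat.pow_le_pow_left (by omega) a)
    (Nat.pow_le_pow_left (modulus_le a D n 0) _)

lemma numPoints_le_rpow (a D n c : ℕ) (hc : a + (12 * a + 9) * 2 ^ a ≤ c) :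
    (numPoints a D n : ℝ) ≤ ((D : ℝ) + n + 2) ^ ((c : ℝ) * lgDivLglg D) := by
  have h1 := one_le_lgDivLglg D
  have h2 := clog_le_lgDivLglg D
  have hX : (1 : ℝ) ≤ (D : ℝ) + n + 2 := by
    have := Nat.cast_nonneg (α := ℝ) D
    have := Nat.cast_nonneg (α := ℝ) n
    linarith
  have h3 : (numPoints a D n : ℝ) ≤ ((D : ℝ) + n + 2) ^
      (a + (4 * a + 3) * ((Nat.clog (D.size + 2) D + 1) * 2 ^ a)) := by
    exact_mod_cast numPoints_le a D n
  refine h3.trans ?_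
  rw [← Real.rpow_natCast]
  refine Real.rpow_le_rpow_of_exponent_le hX ?_
  push_cast
  set L : ℝ := (Nat.clog (D.size + 2) D : ℝ)
  set y := lgDivLglg D
  have hc' : (a : ℝ) + (12 * a + 9) * 2 ^ a ≤ c := by exact_mod_cast hc
  have ha : (0 : ℝ) ≤ a := Nat.cast_nonneg a
  -- Uses `L + 1 ≤ y + 2 ≤ 3 * y`, whence the `12 * a + 9` in `hc`.
  calc (a : ℝ) + (4 * a + 3) * ((L + 1) * 2 ^ a)
      ≤ a * y + (4 * a + 3) * ((3 * y) * 2 ^ a) := by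
        gcongr
        · nlinarith
        · linarith
    _ = (a + (12 * a + 9) * 2 ^ a) * y := by ring
    _ ≤ c * y := by gcongr

/-- A bound for the natural numbers that occur. -/
lemma exists_bounds (a : ℕ) : ∃ C : ℕ, ∀ D n κ : ℕ, κ < numPoints a D n →
    ∃ B, (consts (2 ^ a) D n κ).Bounds B (consts (2 ^ a) D n κ).s ∧ n + 1 ≤ B ∧ κ ≤ B ∧
      (2 ^ a) ^ 2 ≤ B ∧ Costs B (consts (2 ^ a) D n κ).s ((D + n + 2) ^ C) := by
  set C₁ := 6 * a + 8 + (4 * a + 3) * 2 ^ a with hC₁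
  refine ⟨C₁ + 4 * a + 9, fun D n κ hκ => ?_⟩
  set X := D + n + 2 with hX
  have hX2 : 2 ≤ X := by omega
  have hone : ∀ i, 1 ≤ X ^ i := fun i => Nat.one_le_pow _ _ (by omega)
  have hmono : ∀ {i j}, i ≤ j → X ^ i ≤ X ^ j := fun h => Nat.pow_le_pow_right (by omega) h
  have hs := modulus_le a D n κ
  rw [← hX] at hs
  have hsz := size_le_self D
  have hL := clog_le_self D
  have hρ : 2 ^ a ≤ X ^ a := Nat.pow_le_pow_left hX2 a
  have hC₁X : C₁ ≤ C₁ * X := Nat.le_mul_of_pos_right _ (by omega)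
  -- An index may be superpolynomial, but its bit length is polynomial; the crude bound `L ≤ D`
  -- suffices for this.
  have hκB : κ ≤ X ^ (C₁ * X) := by
    refine hκ.le.trans ((numPoints_le a D n).trans (hmono ?_))
    rw [show C₁ * X = (6 * a + 8) * X + (4 * a + 3) * 2 ^ a * X by rw [hC₁]; ring]
    refine add_le_add ?_ ?_
    · exact (show a ≤ 6 * a + 8 by omega).trans (Nat.le_mul_of_pos_right _ (by omega))
    · rw [mul_comm (Nat.clog (D.size + 2) D + 1), ← mul_assoc (4 * a + 3)]
      exact Nat.mul_le_mul_left _ (by omega)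
  have hsB : (consts (2 ^ a) D n κ).s ≤ X ^ (C₁ * X) := hs.trans (hmono (by omega))
  have hRs : (2 ^ a) ^ (D.size + 2) ≤ (consts (2 ^ a) D n κ).s := by
    simp only [consts]
    rw [mul_assoc, mul_assoc]
    exact Nat.le_mul_of_pos_right _ (by positivity)
  have hXB : X ≤ X ^ (C₁ * X) := by
    conv_lhs => rw [← pow_one X]
    exact hmono (by omega)
  have hsize : (X ^ (C₁ * X)).size ≤ C₁ * X * X + 1 := by
    rw [Nat.size_le]
    calc X ^ (C₁ * X) ≤ (2 ^ X) ^ (C₁ * X) := Nat.pow_le_pow_left Nat.lt_two_pow_self.le _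
      _ = 2 ^ (C₁ * X * X) := by rw [← pow_mul]; congr 1; ring
      _ < 2 ^ (C₁ * X * X + 1) := Nat.pow_lt_pow_right (by omega) (by omega)
  -- Numbers up to `B` cost only their bit length, and enumeration indices are bounded by the
  -- polynomial `s`.
  have hw : 3 * (X ^ (C₁ * X)).size + 1 + (consts (2 ^ a) D n κ).s ≤ X ^ (C₁ + 4 * a + 9) := by
    have h1 : C₁ * X * X ≤ X ^ (C₁ + 2) := by
      rw [mul_assoc, ← sq, pow_add]
      exact Nat.mul_le_mul_right _
        (Nat.lt_two_pow_self.le.trans (Nat.pow_le_pow_left hX2 _))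
    have h2 := hmono (show C₁ + 2 ≤ C₁ + 4 * a + 6 by omega)
    have h3 := hmono (show 4 * a + 3 ≤ C₁ + 4 * a + 6 by omega)
    have h4 := hone (C₁ + 4 * a + 6)
    exact le_pow_add (i := C₁ + 4 * a + 6) hX2 3 (by omega)
  refine ⟨X ^ (C₁ * X), ⟨hRs, le_rfl, hsB, ?_, ?_, ?_, ?_, ?_, ?_, ?_, ?_, rfl⟩, ?_, hκB, ?_, ?_⟩
  · exact (Nat.div_le_self _ _).trans hκB
  · simp only [consts]
    refine le_trans (le_pow_add (i := a + 1) hX2 4 ?_) (hmono (j := C₁ * X) (by omega))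
    have h1 := hmono (show a ≤ a + 1 by omega)
    have h2 := hmono (show 1 ≤ a + 1 by omega)
    rw [pow_one] at h2
    omega
  · have := Nat.mod_lt κ (Nat.two_pow_pos a)
    simp only [consts]
    omega
  · simp [consts]
  · simp only [consts]
    refine le_trans (show _ ≤ X * X from Nat.mul_le_mul (by omega) (by omega)) ?_
    rw [← sq]
    exact hmono (by omega)
  · exact Nat.two_pow_pos a
  · simp [consts]
  · simp only [consts]
    positivity
  · omega
  · exact (Nat.pow_le_pow_left hρ 2).trans (by rw [← pow_mul]; exact hmono (by omega))
  · have hsz' : ∀ v ≤ X ^ (C₁ * X), v.size ≤ (X ^ (C₁ * X)).size := fun v hv => Nat.size_le_size hv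
    refine ⟨fun v hv => ?_, fun v hv i hi => ?_⟩
    · have := hsz' v hv
      omega
    · have := hsz' v hv
      omega

/-- The lowest digit of the index, in base `ρ`, selects one of the `ρ` points; the quotient carries
the `(L + 1) * ρ` seeds in base `s`. -/
lemma exists_index {F : Type*} [Field F] (e : ℕ → F) (ρ s k R L : ℕ) (hρ : 0 < ρ) (hs : 0 < s)
    (σ : ℕ → ℕ) (hσ : ∀ t, σ t < s) (i : ℕ) (hi : i < ρ) :
    ∃ κ < ρ * s ^ ((L + 1) * ρ), ∀ x,
      gen e (seeds (κ / ρ) s) ρ k R L (κ % ρ) x = gen e σ ρ k R L i x := by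
  obtain ⟨κ', hκ', h⟩ := exists_digits s hs σ hσ ((L + 1) * ρ)
  refine ⟨i + ρ * κ', ?_, fun x => ?_⟩
  · calc i + ρ * κ' < ρ + ρ * κ' := by omega
      _ = ρ * (κ' + 1) := by ring
      _ ≤ _ := Nat.mul_le_mul_left _ hκ'
  · rw [Nat.add_mul_div_left _ _ hρ, Nat.div_eq_of_lt hi, zero_add, Nat.add_mul_mod_self_left,
      Nat.mod_eq_of_lt hi]
    exact gen_congr e ρ k R L hi h

end ROABP

end

theorem mainTheorem2 (r : ℕ) :
    ∃ (c : ℕ) (P : ROABP.Program),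
      ∀ (D n : ℕ) (F : Type*) [Field F] (e : ℕ → F), ROABP.IsEnumeration e →
        (((D + n + 2) ^ c : ℕ) : ℕ∞) ≤ ENat.card F →
        ∃ (N : ℕ) (pt : Fin N → Fin D → F),
          ROABP.IsHittingSet (Set.range pt) (ROABP.computable F r D n) ∧
          (N : ℝ) ≤ ((D : ℝ) + n + 2) ^ ((c : ℝ) * ROABP.lgDivLglg D) ∧
          ∀ k : Fin N, P.OutputsWithin e [D, n, k] (pt k) ((D + n + 2) ^ c) := by
  -- The number of points per level is `2 ^ a`, which is at least `r * r`, and positive even for `r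
  -- = 0`.
  set a := r * r with ha
  obtain ⟨C, hC⟩ := ROABP.exists_bounds a
  -- The exponent adds up what is needed for the number of points, for the cost of one instruction
  -- and for the number of steps.
  refine ⟨a + (12 * a + 9) * 2 ^ a + (C + (9 * a + 26)), ROABP.pointProg (2 ^ a),
    fun D n F _ e he hF => ?_⟩
  set c := a + (12 * a + 9) * 2 ^ a + (C + (9 * a + 26)) with hc
  set s := (ROABP.consts (2 ^ a) D n 0).s with hs
  set L := Nat.clog (D.size + 2) D with hL
  have hρ : 0 < 2 ^ a := Nat.two_pow_pos a
  have hX : 0 < D + n + 2 := by omega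
  have hsc : s ≤ (D + n + 2) ^ c :=
    (ROABP.modulus_le a D n 0).trans (Nat.pow_le_pow_right hX (by omega))
  have he' : Set.InjOn e (Set.Iio s) := he.mono fun t ht => by
    have : t < (D + n + 2) ^ c := lt_of_lt_of_le ht hsc
    exact lt_of_lt_of_le (by exact_mod_cast this) hF
  refine ⟨ROABP.numPoints a D n, fun κ x => ROABP.gen e (ROABP.seeds (κ / 2 ^ a) s) (2 ^ a)
    (D.size + 2) ((2 ^ a) ^ (D.size + 2)) L (κ % 2 ^ a) x, fun f hf => ⟨?_, fun h => ?_⟩,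
    ROABP.numPoints_le_rpow a D n c (by omega), fun κ => ?_⟩
  · rintro rfl p _
    simp
  · by_contra hf0
    have hR0 : 0 < (2 ^ a) ^ (D.size + 2) := pow_pos hρ _
    have hsR : s = (2 ^ a) ^ (D.size + 2) * ((D + 1) * ((D + 1) * (n + 1))) := by
      simp only [hs, ROABP.consts]
      ring
    obtain ⟨σ, hσ, i, hi, hne⟩ := ROABP.exists_eval_gen_ne_zero r (2 ^ a) (D.size + 2) s L
      Nat.lt_two_pow_self.le hρ (by omega) (Nat.le_pow_clog (by omega) D) e he'
      (hsR ▸ ROABP.degree_lt_modulus hR0 D n) (hsR ▸ ROABP.le_modulus _ D n)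
      (hsR ▸ ROABP.mul_lt_modulus hR0 D n) hf hf0
    have hs0 : 0 < s := (Nat.zero_le _).trans_lt (hσ 0)
    obtain ⟨κ, hκ, hgen⟩ := ROABP.exists_index e (2 ^ a) s (D.size + 2)
      ((2 ^ a) ^ (D.size + 2)) L hρ hs0 σ hσ i hi
    apply hne
    have := h _ ⟨⟨κ, hκ⟩, rfl⟩
    simpa only [hgen] using this
  · obtain ⟨B, hB, hn, hκB, hρB, hcost⟩ := hC D n κ κ.2
    obtain ⟨s', t, hex, ht, hout⟩ := ROABP.tri_pointProg (e := e) hcost (2 ^ a) D n κ hB hn hκB hρB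
    refine ⟨s', t, hex, ht.trans ?_, fun x => hout x x.2⟩
    refine (Nat.mul_le_mul_left _ (ROABP.steps_le a D n κ)).trans ?_
    rw [← pow_add]
    exact Nat.pow_le_pow_right hX (by omega)
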